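/- Let $M$ be a model of Zermelo--Fraenkel set theory ZF (without any axiom of choice) in which the uniform boundedness principle (UBP) holds, that is, in which the following statement is true: whenever $X$ is a real Banach space (a normed space in which every Cauchy sequence converges), $Y$ is a real normed space and $(T_\alpha)_{\alpha\in A}$ is a family of continuous linear maps $X\to Y$ with $\sup_{\alpha\in A}\|T_\alpha x\|_Y<\infty$ for every $x\in X$, then $\sup_{\alpha\in A}\|T_\alpha\|_{op}<\infty$. Then the following three statements are also true in $M$. 1. For every sequence $(S_n)_{n\in\mathbb N}$ of nonempty sets there is a sequence $(M_n)_{n\in\mathbb N}$ of finite sets such that $M_n\subseteq S_n$ for all $n\in\mathbb N$, and $M_n\neq\emptyset$ for infinitely many $n$. 2. (Partial countable multiple choice.) For every sequence $(S_n)_{n\in\mathbb N}$ of nonempty sets there are an infinite set $I\subseteq\mathbb N$ and a family $(M_n)_{n\in I}$ of nonempty finite sets with $M_n\subseteq S_n$ for all $n\in I$. 3. (Countable multiple choice.) For every sequence $(S_n)_{n\in\mathbb N}$ of nonempty sets there is a sequence $(M_n)_{n\in\mathbb N}$ of nonempty finite sets with $M_n\subseteq S_n$ for all $n\in\mathbb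 N$. In other words: over ZF, the uniform boundedness principle implies each of the statements 1, 2 and 3. (All notions in these statements, such as the natural and the real numbers, finiteness, sequences and families, are understood in the sense of $M$.) -/

import Mathlib

universe u

namespace ZFModel

/-- The relation symbols of the language of set theory: one binary symbol. -/
inductive SetRel : ℕ → Type
  | mem : SetRel 2

/-- The first-order language of set theory. -/
def setLang : FirstOrder.Language.{0, 0} := ⟨fun _ => Empty, SetRel⟩

variable {M : Type u} [setLang.Structure M]

/-- The membership relation of a structure `M` for the language of set theory. -/
def Mem (x y : M) : Prop :=
  FirstOrder.Language.Structure.RelMap (L := setLang) (n := 2) SetRel.mem ![x, y]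

infix:50 " ∈ₘ " => Mem

/-- `a ⊆ b` in the sense of `M`. -/
def Sub (a b : M) : Prop := ∀ x : M, x ∈ₘ a → x ∈ₘ b

infix:50 " ⊆ₘ " => Sub

/-- `a ≠ ∅` in the sense of `M`. -/
def Inhab (a : M) : Prop := ∃ x : M, x ∈ₘ a

/-- `s = n ∪ {n}` in the sense of `M`. -/
def IsSucc (s n : M) : Prop := ∀ x : M, x ∈ₘ s ↔ x ∈ₘ n ∨ x = n

/-- `w` contains the empty set and is closed under successors. -/
def IsInductive (w : M) : Prop :=
  (∃ z : M, z ∈ₘ w ∧ ¬ Inhab z) ∧ ∀ n : M, n ∈ₘ w → ∃ s : M, s ∈ₘ w ∧ IsSucc s n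

/-- `w` is the set `ω` of natural numbers of `M`: the least inductive set. -/
def IsOmega (w : M) : Prop :=
  IsInductive w ∧ ∀ v : M, IsInductive v → w ⊆ₘ v

/-- `M` is a model of the first-order theory ZF (without any form of choice). In the two schemes,
`Definable` with parameter set `Set.univ` means: defined by a first-order formula of the language
of set theory with parameters from `M`. -/
structure IsZF (M : Type u) [setLang.Structure M] : Prop where
  extensionality : ∀ a b : M, (∀ x : M, x ∈ₘ a ↔ x ∈ₘ b) → a = b
  foundation : ∀ a : M, Inhab a → ∃ x : M, x ∈ₘ a ∧ ∀ y : M, y ∈ₘ a → ¬ y ∈ₘ x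
  pairing : ∀ a b : M, ∃ c : M, ∀ x : M, x ∈ₘ c ↔ x = a ∨ x = b
  union : ∀ a : M, ∃ c : M, ∀ x : M, x ∈ₘ c ↔ ∃ y : M, y ∈ₘ a ∧ x ∈ₘ y
  powerset : ∀ a : M, ∃ c : M, ∀ x : M, x ∈ₘ c ↔ x ⊆ₘ a
  infinity : ∃ w : M, IsInductive w
  separation : ∀ P : Set M, (Set.univ : Set M).Definable₁ setLang P →
    ∀ a : M, ∃ b : M, ∀ x : M, x ∈ₘ b ↔ x ∈ₘ a ∧ x ∈ P
  replacement : ∀ F : Set (M × M), (Set.univ : Set M).Definable₂ setLang F →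
    ∀ a : M, (∀ x : M, x ∈ₘ a → ∀ y z : M, (x, y) ∈ F → (x, z) ∈ F → y = z) →
      ∃ b : M, ∀ y : M, y ∈ₘ b ↔ ∃ x : M, x ∈ₘ a ∧ (x, y) ∈ F

/-- The elements, in the sense of `M`, of the set `a` of `M`. -/
def El (a : M) : Type u := {x : M // x ∈ₘ a}

/-- `p` is the Kuratowski pair `{{x}, {x, y}}` in the sense of `M`. -/
def IsOPair (p x y : M) : Prop :=
  ∀ z : M, z ∈ₘ p ↔ (∀ t : M, t ∈ₘ z ↔ t = x) ∨ (∀ t : M, t ∈ₘ z ↔ t = x ∨ t = y)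

/-! Only subsets, relations, functions and families that are sets of `M` count for `M`. The next
four predicates single them out: the subset, or the graph, is an element of `M`. -/

/-- The subset `B` of `a` is a set of `M`. -/
def InternalSet {a : M} (B : Set (El a)) : Prop :=
  ∃ b : M, ∀ x : M, x ∈ₘ b ↔ ∃ y : El a, y ∈ B ∧ x = y.1

/-- The relation `r` between `a` and `b` is a set of `M`. -/
def InternalRel {a b : M} (r : El a → El b → Prop) : Prop :=
  ∃ g : M, ∀ p : M, p ∈ₘ g ↔ ∃ (x : El a) (y : El b), r x y ∧ IsOPair p x.1 y.1

/-- The function `f` with domain `a` (a family of sets indexed by `a`) is a set of `M`. -/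
def Internal {a : M} (f : El a → M) : Prop :=
  ∃ g : M, ∀ p : M, p ∈ₘ g ↔ ∃ x : El a, IsOPair p x.1 (f x)

/-- The function `f` with domain `a × b` is a set of `M`. -/
def Internal₂ {a b : M} (f : El a → El b → M) : Prop :=
  ∃ g : M, ∀ p : M, p ∈ₘ g ↔
    ∃ (x : El a) (y : El b) (q : M), IsOPair q x.1 y.1 ∧ IsOPair p q (f x y)

/-- `a` is finite in the sense of `M`: some function of `M` is a bijection from a natural number
of `M` (the set of its predecessors) onto `a`. -/
def IsFin (a : M) : Prop :=
  ∃ w : M, IsOmega w ∧ ∃ (n : El w) (f : El n.1 → El a),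
    Internal (fun k => (f k).1) ∧ Function.Bijective f

/-- The order of the natural numbers of `M`. -/
def NatLE {w : M} (m n : El w) : Prop := m.1 ∈ₘ n.1 ∨ m = n

/-! ### Analysis inside a model -/

/-- The ordered field `R` is the field of real numbers of `M`: its operations and its order are
sets of `M`, and every nonempty bounded above subset that is a set of `M` has a supremum. -/
structure IsRealField (R : M) [Field (El R)] [LinearOrder (El R)]
    [IsStrictOrderedRing (El R)] : Prop where
  internal_add : Internal₂ (fun x y : El R => (x + y).1)
  internal_mul : Internal₂ (fun x y : El R => (x * y).1)
  internal_le : InternalRel (fun x y : El R => x ≤ y)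
  exists_isLUB : ∀ B : Set (El R), InternalSet B → B.Nonempty → BddAbove B →
    ∃ c : El R, IsLUB B c

/-- The vector space `X` with the function `nX` is a normed space of `M`. -/
structure IsNormedSpace (R : M) [Field (El R)] [LinearOrder (El R)] [IsStrictOrderedRing (El R)]
    (X : M) [AddCommGroup (El X)] [Module (El R) (El X)] (nX : El X → El R) : Prop where
  internal_add : Internal₂ (fun x y : El X => (x + y).1)
  internal_smul : Internal₂ (fun (c : El R) (x : El X) => (c • x).1)
  internal_norm : Internal (fun x : El X => (nX x).1)
  norm_eq_zero : ∀ x : El X, nX x = 0 ↔ x = 0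
  norm_add_le : ∀ x y : El X, nX (x + y) ≤ nX x + nX y
  norm_smul : ∀ (c : El R) (x : El X), nX (c • x) = |c| * nX x

/-- `X` is a Banach space of `M`: every Cauchy sequence of `M` in `X` converges. -/
structure IsBanachSpace (R : M) [Field (El R)] [LinearOrder (El R)] [IsStrictOrderedRing (El R)]
    (X : M) [AddCommGroup (El X)] [Module (El R) (El X)] (nX : El X → El R) : Prop
    extends IsNormedSpace R X nX where
  complete : ∀ w : M, IsOmega w → ∀ s : El w → El X, Internal (fun n => (s n).1) →
    (∀ ε : El R, 0 < ε → ∃ N : El w, ∀ m n : El w, NatLE N m → NatLE N n →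
      nX (s m - s n) < ε) →
    ∃ x : El X, ∀ ε : El R, 0 < ε → ∃ N : El w, ∀ n : El w, NatLE N n → nX (s n - x) < ε

/-- Continuity with respect to the norms `nX` and `nY`. -/
def NormContinuous {R X Y : M} [Field (El R)] [LinearOrder (El R)]
    [AddCommGroup (El X)] [AddCommGroup (El Y)]
    (nX : El X → El R) (nY : El Y → El R) (f : El X → El Y) : Prop :=
  ∀ x : El X, ∀ ε : El R, 0 < ε → ∃ δ : El R, 0 < δ ∧
    ∀ y : El X, nX (y - x) < δ → nY (f y - f x) < ε

/-- `c` is the operator norm of `f`: the supremum of `‖f x‖` over all `x` with `‖x‖ ≤ 1`. -/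
def IsOpNorm {R X Y : M} [Field (El R)] [LinearOrder (El R)]
    (nX : El X → El R) (nY : El Y → El R) (f : El X → El Y) (c : El R) : Prop :=
  IsLUB {t : El R | ∃ x : El X, nX x ≤ 1 ∧ t = nY (f x)} c

/-- The uniform boundedness principle holds in `M`: if a family `(T α)`, `α ∈ A`, of continuous
linear maps from a Banach space to a normed space is pointwise bounded, then the operator norms of
its members are bounded. All spaces, functions and families are those of `M`, so that this is the
satisfaction in `M` of the usual statement in the language of set theory; the algebraic instances
only name the operations of `M` on the elements of `R`, `X` and `Y`. -/
def UBP (M : Type u) [setLang.Structure M] : Prop :=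
  ∀ (R : M) [Field (El R)] [LinearOrder (El R)] [IsStrictOrderedRing (El R)], IsRealField R →
  ∀ (X : M) [AddCommGroup (El X)] [Module (El R) (El X)] (nX : El X → El R),
    IsBanachSpace R X nX →
  ∀ (Y : M) [AddCommGroup (El Y)] [Module (El R) (El Y)] (nY : El Y → El R),
    IsNormedSpace R Y nY →
  ∀ (A : M) (T : El A → El X →ₗ[El R] El Y),
    Internal₂ (fun α x => (T α x).1) →
    (∀ α, NormContinuous nX nY (T α)) →
    (∀ x, ∃ C : El R, ∀ α, nY (T α x) ≤ C) →
    ∃ C : El R, ∀ α, ∃ c : El R, IsOpNorm nX nY (T α) c ∧ c ≤ C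

/-! ### Multiple choice inside a model -/

/-- In `M`, every sequence `(S n)` of nonempty sets has a sequence `(F n)` of finite sets with
`F n ⊆ S n` for all `n` and `F n ≠ ∅` for infinitely many `n`. -/
def FiniteSubsetSelection (M : Type u) [setLang.Structure M] : Prop :=
  ∀ w : M, IsOmega w → ∀ S : El w → M, Internal S → (∀ n, Inhab (S n)) →
    ∃ F : El w → M, Internal F ∧ (∀ n, F n ⊆ₘ S n ∧ IsFin (F n)) ∧
      ∃ I : M, (∀ x : M, x ∈ₘ I ↔ ∃ n : El w, x = n.1 ∧ Inhab (F n)) ∧ ¬ IsFin I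

/-- The axiom of partial countable multiple choice holds in `M`. -/
def PCMC (M : Type u) [setLang.Structure M] : Prop :=
  ∀ w : M, IsOmega w → ∀ S : El w → M, Internal S → (∀ n, Inhab (S n)) →
    ∃ (I : M) (hI : I ⊆ₘ w), ¬ IsFin I ∧
      ∃ F : El I → M, Internal F ∧
        ∀ n : El I, Inhab (F n) ∧ F n ⊆ₘ S ⟨n.1, hI n.1 n.2⟩ ∧ IsFin (F n)

/-- The axiom of countable multiple choice holds in `M`. -/
def CMC (M : Type u) [setLang.Structure M] : Prop :=
  ∀ w : M, IsOmega w → ∀ S : El w → M, Internal S → (∀ n, Inhab (S n)) →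
    ∃ F : El w → M, Internal F ∧ ∀ n, Inhab (F n) ∧ F n ⊆ₘ S n ∧ IsFin (F n)

end ZFModel

-- The analytic core is as follows. Let a set `D` of `M` be partitioned into nonempty blocks `D_n`,
-- and let `c₀(D)` be the Banach space of real functions on `D` that tend to zero along the finite
-- sets, with the supremum norm. Let `T_n x` be `n` times the restriction of `x` to `D_n`. If every
-- `x` in `c₀(D)` vanished on all blocks from some index on, the family `(T_n)` would be pointwise
-- bounded; but the indicator of a point of `D_n` shows that `T_n` has norm at least `n`, against
-- uniform boundedness. So some `x` is nonzero somewhere on infinitely many blocks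
-- (`UBP.exists_c0`). On such a block `|x|` has a positive maximum, attained at only finitely many
-- points, and the set of these points is determined by `x` (`UBP.exists_finite`).
--
-- To pass from infinitely many indices to all of them, let `D_n` consist of the sequences whose
-- terms with index `k ≤ n` lie in `S_k`; it is nonempty by finite choice, that is, by induction in
-- `M`. For each `k`, take the least `n ≥ k` whose finite subset of `D_n` is nonempty and evaluate
-- its members at `k`: this gives a nonempty finite subset of `S_k` (`UBP.exists_multipleChoice`).
-- Statement 3 follows, and it yields the other two with index set `ω`, which is infinite
-- (`not_isFin_omega`).
--
-- All this must happen inside `M`, whose natural and real numbers may be nonstandard. `Code M α`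
-- identifies a type with the elements of a set of `M`, and `Inn M f` says that the graph of `f` is
-- a set of `M`. Inner functions are closed under composition, pairing, currying, logical
-- connectives, quantifiers over coded types and unique description, so `fun_prop` can check that a
-- construction stays in `M`. The numbers and `c₀` are built as coded types, with induction
-- restricted to inner predicates. No choice in `M` is involved: where `choose` forms a function of
-- `M`, its values are uniquely determined.

universe v

set_option linter.unusedSectionVars false

/-! ### Definability with parameters. -/

namespace ZFModel

open FirstOrder Language

variable {M : Type u}

/-- Definability (with parameters) of a predicate on valuations. -/
def Dfn [setLang.Structure M] (P : (ℕ → M) → Prop) : Prop :=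
  ∃ φ : setLang.Formula (M ⊕ ℕ), ∀ v, P v ↔ φ.Realize (Sum.elim id v)

/-- The valuation `v` with `x` put in front. -/
def push (x : M) (v : ℕ → M) : ℕ → M := fun n => n.casesOn x v

@[simp] theorem push_zero (x : M) (v : ℕ → M) : push x v 0 = x := rfl

@[simp] theorem push_succ (x : M) (v : ℕ → M) (n : ℕ) : push x v (n + 1) = v n := rfl

/-- Variables and parameters. -/
inductive Atom : ((ℕ → M) → M) → Prop
  | var (i : ℕ) : Atom fun v => v i
  | par (c : M) : Atom fun _ => c

theorem Atom.exists_term {t : (ℕ → M) → M} (h : Atom t) :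
    ∃ s : M ⊕ ℕ, ∀ v, t v = Sum.elim id v s := by
  cases h with
  | var i => exact ⟨.inr i, fun v => rfl⟩
  | par c => exact ⟨.inl c, fun v => rfl⟩

variable [setLang.Structure M]

namespace Dfn

theorem not {P : (ℕ → M) → Prop} (h : Dfn P) : Dfn fun v => ¬ P v := by
  obtain ⟨φ, hφ⟩ := h
  exact ⟨φ.not, fun v => not_congr (hφ v)⟩

theorem imp {P Q : (ℕ → M) → Prop} (h : Dfn P) (h' : Dfn Q) : Dfn fun v => P v → Q v := by
  obtain ⟨φ, hφ⟩ := h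
  obtain ⟨ψ, hψ⟩ := h'
  exact ⟨φ.imp ψ, fun v => imp_congr (hφ v) (hψ v)⟩

theorem and {P Q : (ℕ → M) → Prop} (h : Dfn P) (h' : Dfn Q) : Dfn fun v => P v ∧ Q v := by
  simpa using (h.imp h'.not).not

theorem or {P Q : (ℕ → M) → Prop} (h : Dfn P) (h' : Dfn Q) : Dfn fun v => P v ∨ Q v := by
  simpa [or_iff_not_imp_left] using h.not.imp h'

theorem iff {P Q : (ℕ → M) → Prop} (h : Dfn P) (h' : Dfn Q) : Dfn fun v => P v ↔ Q v := by
  simpa [iff_iff_implies_and_implies] using (h.imp h').and (h'.imp h)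

/-- Bound variables follow the de Bruijn convention: under the quantifier, variable `0` is the bound
one and the outer variables are shifted by one. -/
theorem ex {P : M → (ℕ → M) → Prop} (h : Dfn fun v => P (v 0) fun n => v (n + 1)) :
    Dfn fun v => ∃ x, P x v := by
  obtain ⟨φ, hφ⟩ := h
  let g : M ⊕ ℕ → (M ⊕ ℕ) ⊕ Unit :=
    Sum.elim (fun c => .inl (.inl c)) fun n => n.casesOn (.inr ()) fun k => .inl (.inr k)
  refine ⟨(φ.relabel g).iExs Unit, fun v => ?_⟩
  rw [Formula.realize_iExs]
  have key (i : Unit → M) : Sum.elim (Sum.elim id v) i ∘ g = Sum.elim id (push (i ()) v) := by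
    ext (c | n)
    · rfl
    · cases n <;> rfl
  constructor
  · rintro ⟨x, hx⟩
    refine ⟨fun _ => x, ?_⟩
    rw [Formula.realize_relabel, key, ← hφ]
    exact hx
  · rintro ⟨i, hi⟩
    rw [Formula.realize_relabel, key, ← hφ] at hi
    exact ⟨i (), hi⟩

theorem all {P : M → (ℕ → M) → Prop} (h : Dfn fun v => P (v 0) fun n => v (n + 1)) :
    Dfn fun v => ∀ x, P x v := by
  simpa using (ex (P := fun x v => ¬ P x v) h.not).not

theorem mem {s t : (ℕ → M) → M} (hs : Atom s) (ht : Atom t) : Dfn fun v => s v ∈ₘ t v := by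
  obtain ⟨s', hs⟩ := hs.exists_term
  obtain ⟨t', ht⟩ := ht.exists_term
  refine ⟨Relations.formula₂ (L := setLang)
    (show setLang.Relations 2 from SetRel.mem) (Term.var s') (Term.var t'), fun v => ?_⟩
  refine Iff.trans ?_ Formula.realize_rel₂.symm
  simp only [hs, ht]
  rfl

theorem eq {s t : (ℕ → M) → M} (hs : Atom s) (ht : Atom t) : Dfn fun v => s v = t v := by
  obtain ⟨s', hs⟩ := hs.exists_term
  obtain ⟨t', ht⟩ := ht.exists_term
  refine ⟨Term.equal (Term.var s') (Term.var t'), fun v => ?_⟩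
  refine Iff.trans ?_ Formula.realize_equal.symm
  simp only [hs, ht]
  rfl

theorem definable₁ {P : M → Prop} (h : Dfn fun v => P (v 0)) :
    (Set.univ : Set M).Definable₁ setLang {x | P x} := by
  obtain ⟨φ, hφ⟩ := h
  rw [Set.Definable₁, Set.definable_iff_exists_formula_sum]
  -- All variables are merged into one. This is harmless because the truth of `φ` depends only on
  -- variable `0`.
  refine ⟨φ.relabel (Sum.map (fun c => ⟨c, trivial⟩) fun _ => 0), ?_⟩
  ext x
  simp only [Set.mem_ofPred_eq, Formula.realize_relabel]
  rw [show P (x 0) ↔ _ from hφ fun _ => x 0]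
  refine iff_of_eq (congrArg _ ?_)
  ext (c | n) <;> rfl

/-- After the case split every term is an explicit variable or parameter. It remains one when
shifted under a quantifier, so the closure rules apply mechanically. -/
theorem isOPair {s t r : (ℕ → M) → M} (hs : Atom s) (ht : Atom t) (hr : Atom r) :
    Dfn fun v => IsOPair (s v) (t v) (r v) := by
  unfold IsOPair
  cases hs <;> cases ht <;> cases hr <;>
  repeat' first
    | exact .var _ | exact .par _ | apply mem | apply eq | apply all | apply iff | apply or
end Dfn

end ZFModel

/-! ### Pairs, products and coded types in a model of ZF. -/

namespace ZFModel

variable {M : Type u} [setLang.Structure M]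

/-- `M` is a model of ZF, as a class. -/
class ZF (M : Type u) [setLang.Structure M] : Prop where
  out : IsZF M

section Basic

variable [ZF M]

theorem ext_mem {a b : M} (h : ∀ x : M, x ∈ₘ a ↔ x ∈ₘ b) : a = b :=
  ZF.out.extensionality a b h

theorem exists_sep (P : M → Prop) (h : Dfn fun v : ℕ → M => P (v 0)) (a : M) :
    ∃ b : M, ∀ x, x ∈ₘ b ↔ x ∈ₘ a ∧ P x :=
  ZF.out.separation {x | P x} h.definable₁ a

theorem exists_singleton (x : M) : ∃ c : M, ∀ t, t ∈ₘ c ↔ t = x := by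
  obtain ⟨c, hc⟩ := ZF.out.pairing x x
  exact ⟨c, fun t => by simp [hc]⟩

theorem exists_isOPair (x y : M) : ∃ p : M, IsOPair p x y := by
  obtain ⟨s, hs⟩ := exists_singleton x
  obtain ⟨d, hd⟩ := ZF.out.pairing x y
  obtain ⟨p, hp⟩ := ZF.out.pairing s d
  refine ⟨p, fun z => ?_⟩
  rw [hp]
  refine or_congr ⟨?_, fun h => ext_mem fun t => ?_⟩ ⟨?_, fun h => ext_mem fun t => ?_⟩
  · rintro rfl
    exact hs
  · rw [h, hs]
  · rintro rfl
    exact hd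
  · rw [h, hd]

/-- The Kuratowski pair. -/
noncomputable def opair (x y : M) : M := (exists_isOPair x y).choose

theorem isOPair_iff {p x y : M} : IsOPair p x y ↔ p = opair x y := by
  have h : IsOPair (opair x y) x y := (exists_isOPair x y).choose_spec
  constructor
  · exact fun h' => ext_mem fun z => (h' z).trans (h z).symm
  · rintro rfl
    exact h

theorem opair_inj {x y x' y' : M} : opair x y = opair x' y' ↔ x = x' ∧ y = y' := by
  refine ⟨fun h => ?_, fun ⟨h, h'⟩ => by rw [h, h']⟩
  have h1 : IsOPair (opair x y) x y := isOPair_iff.2 rfl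
  have h2 : IsOPair (opair x y) x' y' := isOPair_iff.2 h
  have h3 := fun z => (h1 z).symm.trans (h2 z)
  obtain ⟨s, hs⟩ := exists_singleton x
  obtain ⟨d, hd⟩ := ZF.out.pairing x y
  obtain ⟨s', hs'⟩ := exists_singleton x'
  obtain ⟨d', hd'⟩ := ZF.out.pairing x' y'
  have hx : x = x' := by
    rcases (h3 s).1 (.inl hs) with h | h
    · exact (hs x').1 ((h x').2 rfl) |>.symm
    · exact (hs x').1 ((h x').2 (.inl rfl)) |>.symm
  subst hx
  refine ⟨rfl, ?_⟩
  -- Half of the comparison of second coordinates. The alternative `y = x` covers the degenerate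
  -- pair `{{x}}`; using both directions removes it.
  have k : ∀ y y' : M, (∀ z : M, (∀ t, t ∈ₘ z ↔ t = x) ∨ (∀ t, t ∈ₘ z ↔ t = x ∨ t = y) ↔
      (∀ t, t ∈ₘ z ↔ t = x) ∨ (∀ t, t ∈ₘ z ↔ t = x ∨ t = y')) → y = x ∨ y = y' := by
    intro y y' h
    obtain ⟨d, hd⟩ := ZF.out.pairing x y
    rcases (h d).1 (.inr hd) with h | h
    · exact .inl ((h y).1 ((hd y).2 (.inr rfl)))
    · exact (h y).1 ((hd y).2 (.inr rfl))
  rcases k y y' h3 with h | h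
  · rcases k y' y fun z => (h3 z).symm with h' | h'
    · rw [h, h']
    · exact h'.symm
  · exact h

/-- A pair with coordinates in `a` and `b` is a set of subsets of `a ∪ b`, so the product is
separated from the double power set of `a ∪ b`. -/
theorem exists_prod (a b : M) :
    ∃ c : M, ∀ p, p ∈ₘ c ↔ ∃ x y, x ∈ₘ a ∧ y ∈ₘ b ∧ p = opair x y := by
  obtain ⟨e, he⟩ := ZF.out.pairing a b
  obtain ⟨s, hs⟩ := ZF.out.union e
  obtain ⟨p₁, hp₁⟩ := ZF.out.powerset s
  obtain ⟨p₂, hp₂⟩ := ZF.out.powerset p₁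
  obtain ⟨c, hc⟩ := exists_sep (fun p => ∃ x y, x ∈ₘ a ∧ y ∈ₘ b ∧ IsOPair p x y) (by
    repeat' first
      | exact .var _ | exact .par _ | apply Dfn.isOPair | apply Dfn.mem | apply Dfn.and
      | apply Dfn.ex) p₂
  simp only [isOPair_iff] at hc
  refine ⟨c, fun p => (hc p).trans (and_iff_right_of_imp ?_)⟩
  rintro ⟨x, y, hx, hy, h⟩
  rw [← isOPair_iff] at h
  rw [hp₂]
  intro z hz
  rw [hp₁]
  intro t ht
  rw [hs]
  rcases (h z).1 hz with h | h
  · exact ⟨a, (he a).2 (.inl rfl), (h t).1 ht ▸ hx⟩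
  · rcases (h t).1 ht with rfl | rfl
    · exact ⟨a, (he a).2 (.inl rfl), hx⟩
    · exact ⟨b, (he b).2 (.inr rfl), hy⟩

end Basic

/-- An identification of `α` with the type of elements of a set of `M`. -/
class Code (M : Type u) [setLang.Structure M] (α : Type v) where
  /-- The set of codes. -/
  dom : M
  /-- The code of an element. -/
  code : α → M
  inj : Function.Injective code
  mem_dom : ∀ x : M, x ∈ₘ dom ↔ ∃ a, code a = x


variable {α β γ δ : Type*} [Code M α] [Code M β] [Code M γ] [Code M δ]

@[simp] theorem code_mem (a : α) : (Code.code a : M) ∈ₘ Code.dom α := (Code.mem_dom _).2 ⟨a, rfl⟩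

@[simp] theorem code_inj {a b : α} : (Code.code a : M) = Code.code b ↔ a = b := Code.inj.eq_iff

end ZFModel

/-! ### The calculus of inner functions. -/

namespace ZFModel

open Code (dom code)

variable {M : Type u} [setLang.Structure M] [ZF M]
variable {α β γ δ : Type*} [Code M α] [Code M β] [Code M γ] [Code M δ]

variable (M) in
/-- The graph of `f` is a set of `M`. -/
@[fun_prop]
def Inn (f : α → β) : Prop :=
  ∃ g : M, ∀ p : M, p ∈ₘ g ↔ ∃ a, p = opair (code a) (code (f a))

/-- `(x, y) ∈ g`. -/
def PairMem (g x y : M) : Prop := ∃ p : M, IsOPair p x y ∧ p ∈ₘ g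

theorem pairMem_iff {g x y : M} : PairMem g x y ↔ opair x y ∈ₘ g := by
  simp [PairMem, isOPair_iff]

theorem Dfn.pairMem {s t r : (ℕ → M) → M} (hs : Atom s) (ht : Atom t) (hr : Atom r) :
    Dfn fun v => PairMem (s v) (t v) (r v) := by
  unfold PairMem
  cases hs <;> cases ht <;> cases hr <;>
  repeat' first
    | exact .var _ | exact .par _ | apply Dfn.mem | apply Dfn.ex | apply Dfn.and
    | apply Dfn.isOPair

/-- The bridge from formulas to inner functions: the graph is separated from the product of the sets
of codes. What `R` says about other elements of `M` does not matter. -/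
theorem Inn.of_dfn {f : α → β} (R : M → M → Prop) (hR : Dfn fun v : ℕ → M => R (v 0) (v 1))
    (h : ∀ a b, R (code a) (code b) ↔ f a = b) : Inn M f := by
  obtain ⟨c, hc⟩ := exists_prod (dom α : M) (dom β)
  -- The inner quantifier binds variable `0` and the outer one variable `1`, so with this order `R y
  -- x` is literally the hypothesis `hR`.
  obtain ⟨g, hg⟩ := exists_sep (fun p => ∃ x, ∃ y, R y x ∧ IsOPair p y x) (by
    apply Dfn.ex
    apply Dfn.ex
    apply Dfn.and
    · exact hR
    · apply Dfn.isOPair <;> exact .var _) c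
  simp only [isOPair_iff] at hg
  refine ⟨g, fun p => ?_⟩
  rw [hg, hc]
  constructor
  · rintro ⟨⟨x, y, hx, hy, rfl⟩, y', x', hR, h'⟩
    obtain ⟨rfl, rfl⟩ := opair_inj.1 h'
    obtain ⟨a, rfl⟩ := (Code.mem_dom _).1 hx
    obtain ⟨b, rfl⟩ := (Code.mem_dom _).1 hy
    exact ⟨a, by rw [(h _ _).1 hR]⟩
  · rintro ⟨a, rfl⟩
    exact ⟨⟨_, _, code_mem _, code_mem _, rfl⟩, _, _, (h _ _).2 rfl, rfl⟩

variable (M) in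
/-- The graph of an inner function. -/
noncomputable def graph (f : α → β) (h : Inn M f) : M := h.choose

theorem pairMem_graph {f : α → β} {h : Inn M f} {x y : M} :
    PairMem (graph M f h) x y ↔ ∃ a, x = code a ∧ y = code (f a) := by
  rw [pairMem_iff, show opair x y ∈ₘ graph M f h ↔ _ from h.choose_spec _]
  simp only [opair_inj]

theorem graph_inj {f f' : α → β} {h : Inn M f} {h' : Inn M f'} (e : graph M f h = graph M f' h') :
    f = f' := by
  ext a
  have h1 : PairMem (graph M f h) (code a) (code (f a)) := pairMem_graph.2 ⟨a, rfl, rfl⟩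
  rw [e, pairMem_graph] at h1
  obtain ⟨b, hb, hb'⟩ := h1
  rw [code_inj] at hb hb'
  rw [hb', hb]

namespace Inn

@[fun_prop]
theorem id : Inn M fun a : α => a :=
  of_dfn (fun x y => x = y) (Dfn.eq (.var _) (.var _)) (by simp)

@[fun_prop]
theorem const (b : β) : Inn M fun _ : α => b :=
  of_dfn (fun _ y => code b = y) (Dfn.eq (.par _) (.var _)) (by simp)

theorem congr_fun {f g : α → β} (h : ∀ a, f a = g a) (hg : Inn M g) : Inn M f := by
  rwa [show f = g from funext h]

@[fun_prop]
theorem comp {g : β → γ} {f : α → β} (hg : Inn M g) (hf : Inn M f) :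
    Inn M fun a => g (f a) :=
  of_dfn (fun x z => ∃ y, PairMem (graph M f hf) x y ∧ PairMem (graph M g hg) y z) (by
    repeat' first | exact .var _ | exact .par _ | apply Dfn.and | apply Dfn.pairMem | apply Dfn.ex)
    fun a c => by simp [pairMem_graph, eq_comm]

end Inn

/-! ### Products -/

noncomputable instance Code.prod : Code M (α × β) where
  dom := (exists_prod (dom α : M) (dom β)).choose
  code p := opair (code p.1) (code p.2)
  inj p q h := by
    simp only [opair_inj, code_inj] at h
    exact Prod.ext h.1 h.2
  mem_dom p := by
    rw [(exists_prod (dom α : M) (dom β)).choose_spec]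
    simp only [Code.mem_dom]
    constructor
    · rintro ⟨_, _, ⟨a, rfl⟩, ⟨b, rfl⟩, rfl⟩
      exact ⟨(a, b), rfl⟩
    · rintro ⟨⟨a, b⟩, rfl⟩
      exact ⟨_, _, ⟨a, rfl⟩, ⟨b, rfl⟩, rfl⟩

theorem code_prod (p : α × β) : (code p : M) = opair (code p.1) (code p.2) := rfl

namespace Inn

theorem fst' : Inn M (Prod.fst : α × β → α) :=
  of_dfn (fun p x => ∃ y, IsOPair p x y) (by
    repeat' first | exact .var _ | apply Dfn.isOPair | apply Dfn.ex)
    fun a c => by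
      simp only [isOPair_iff, code_prod, opair_inj, code_inj]
      simp

theorem snd' : Inn M (Prod.snd : α × β → β) :=
  of_dfn (fun p y => ∃ x, IsOPair p x y) (by
    repeat' first | exact .var _ | apply Dfn.isOPair | apply Dfn.ex)
    fun a c => by
      simp only [isOPair_iff, code_prod, opair_inj, code_inj]
      simp

@[fun_prop]
theorem fst {f : γ → α × β} (hf : Inn M f) : Inn M fun c => (f c).1 := fst'.comp hf

@[fun_prop]
theorem snd {f : γ → α × β} (hf : Inn M f) : Inn M fun c => (f c).2 := snd'.comp hf

@[fun_prop]
theorem prodMk {f : γ → α} {g : γ → β} (hf : Inn M f) (hg : Inn M g) :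
    Inn M fun c => (f c, g c) :=
  of_dfn (fun c p => ∃ x y, PairMem (graph M f hf) c x ∧ PairMem (graph M g hg) c y ∧
      IsOPair p x y) (by
    repeat' first
      | exact .var _ | exact .par _ | apply Dfn.and | apply Dfn.pairMem | apply Dfn.ex
      | apply Dfn.isOPair)
    fun c p => by
      simp only [isOPair_iff, code_prod, opair_inj, code_inj, pairMem_graph]
      constructor
      · rintro ⟨_, _, ⟨_, rfl, rfl⟩, ⟨_, h, rfl⟩, h'⟩
        subst h
        simpa [Prod.ext_iff, eq_comm] using h'
      · rintro rfl
        exact ⟨_, _, ⟨c, rfl, rfl⟩, ⟨c, rfl, rfl⟩, rfl, rfl⟩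

end Inn

/-! ### Function types -/

variable (M) in
/-- The type of functions of `M`. -/
structure IFun (α β : Type*) [Code M α] [Code M β] where
  /-- The function. -/
  toFun : α → β
  inn : Inn M toFun

/-- Evaluation. -/
def IFun.app (f : IFun M α β) (a : α) : β := f.toFun a

@[simp] theorem IFun.app_mk (f : α → β) (h : Inn M f) (a : α) : IFun.app ⟨f, h⟩ a = f a := rfl

@[ext] theorem IFun.ext {f g : IFun M α β} (h : ∀ a, f.app a = g.app a) : f = g := by
  cases f
  cases g
  congr
  exact funext h

theorem exists_funSet (a b : M) : ∃ c : M, ∀ g, g ∈ₘ c ↔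
    (∀ p, p ∈ₘ g → ∃ x y, x ∈ₘ a ∧ y ∈ₘ b ∧ p = opair x y) ∧
      ∀ x, x ∈ₘ a → ∃ y, ∀ z, PairMem g x z ↔ z = y := by
  obtain ⟨d, hd⟩ := exists_prod a b
  obtain ⟨e, he⟩ := ZF.out.powerset d
  obtain ⟨c, hc⟩ := exists_sep (fun g => ∀ x, x ∈ₘ a → ∃ y, ∀ z, PairMem g x z ↔ z = y) (by
    repeat' first
      | exact .var _ | exact .par _ | apply Dfn.pairMem | apply Dfn.mem | apply Dfn.eq
      | apply Dfn.iff | apply Dfn.imp | apply Dfn.ex | apply Dfn.all) e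
  refine ⟨c, fun g => ?_⟩
  rw [hc, he]
  simp only [Sub, hd]

noncomputable instance Code.iFun : Code M (IFun M α β) where
  dom := (exists_funSet (dom α : M) (dom β)).choose
  code f := graph M f.toFun f.inn
  inj f g h := by
    cases f
    cases g
    congr
    exact graph_inj h
  mem_dom g := by
    rw [(exists_funSet (dom α : M) (dom β)).choose_spec]
    constructor
    · rintro ⟨h1, h2⟩
      have h3 (a : α) : ∃ b : β, ∀ z, PairMem g (code a) z ↔ z = code b := by
        obtain ⟨y, hy⟩ := h2 (code a) (code_mem a)
        obtain ⟨x', y', -, h4, h5⟩ := h1 _ (pairMem_iff.1 ((hy y).2 rfl))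
        obtain ⟨-, rfl⟩ := opair_inj.1 h5
        obtain ⟨b, rfl⟩ := (Code.mem_dom _).1 h4
        exact ⟨b, hy⟩
      -- The values are unique, so no choice in `M` is made; the set `g` itself witnesses that `f`
      -- is inner.
      choose f hf using h3
      have hg : ∀ p, p ∈ₘ g ↔ ∃ a, p = opair (code a) (code (f a)) := by
        intro p
        constructor
        · intro hp
          obtain ⟨x, y, hx, -, rfl⟩ := h1 p hp
          obtain ⟨a, rfl⟩ := (Code.mem_dom _).1 hx
          exact ⟨a, by rw [(hf a y).1 (pairMem_iff.2 hp)]⟩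
        · rintro ⟨a, rfl⟩
          exact pairMem_iff.1 ((hf a _).2 rfl)
      refine ⟨⟨f, g, hg⟩, ext_mem fun p => ?_⟩
      rw [hg, show p ∈ₘ graph M f _ ↔ _ from Exists.choose_spec (⟨g, hg⟩ : Inn M f) p]
    · rintro ⟨f, rfl⟩
      refine ⟨fun p hp => ?_, fun x hx => ?_⟩
      · obtain ⟨a, rfl⟩ := (f.inn.choose_spec p).1 hp
        exact ⟨_, _, code_mem _, code_mem _, rfl⟩
      · obtain ⟨a, rfl⟩ := (Code.mem_dom _).1 hx
        exact ⟨code (f.toFun a), fun z => by simp [pairMem_graph]⟩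

theorem pairMem_code {f : IFun M α β} {x y : M} :
    PairMem (code f) x y ↔ ∃ a, x = code a ∧ y = code (f.app a) := pairMem_graph

namespace Inn

theorem of_iFun (f : IFun M α β) : Inn M f.app := f.inn

@[fun_prop]
theorem app {f : γ → IFun M α β} {g : γ → α} (hf : Inn M f) (hg : Inn M g) :
    Inn M fun c => (f c).app (g c) := by
  have h : Inn M fun p : IFun M α β × α => p.1.app p.2 :=
    of_dfn (fun p y => ∃ f x, IsOPair p f x ∧ PairMem f x y) (by
      repeat' first
        | exact .var _ | exact .par _ | apply Dfn.and | apply Dfn.pairMem | apply Dfn.ex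
        | apply Dfn.isOPair)
      fun c p => by
        simp only [isOPair_iff, code_prod, opair_inj]
        constructor
        · rintro ⟨_, _, ⟨rfl, rfl⟩, h'⟩
          simpa [pairMem_code, eq_comm] using h'
        · rintro rfl
          exact ⟨_, _, ⟨rfl, rfl⟩, pairMem_code.2 ⟨_, rfl, rfl⟩⟩
  exact h.comp (hf.prodMk hg)

theorem of_curry {f : γ → α → β} (h : Inn M fun p : γ × α => f p.1 p.2) (c : γ) : Inn M (f c) :=
  h.comp ((const c).prodMk id)

-- Currying: the graph of `f c` is definable from `c` and the graph of the uncurried function.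
-- Together with `Inn.app` this makes coded types with inner functions cartesian closed.
@[fun_prop]
theorem iFunMk {f : γ → α → β} (h : Inn M fun p : γ × α => f p.1 p.2) (h' : ∀ c, Inn M (f c)) :
    Inn M fun c => IFun.mk (f c) (h' c) :=
  of_dfn (fun c g => g ∈ₘ dom (IFun M α β) ∧ ∀ x y, PairMem g x y ↔
      ∃ p, IsOPair p c x ∧ PairMem (graph M _ h) p y) (by
    repeat' first
      | exact .var _ | exact .par _ | apply Dfn.and | apply Dfn.pairMem | apply Dfn.ex
      | apply Dfn.isOPair | apply Dfn.mem | apply Dfn.all | apply Dfn.iff)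
    fun c g => by
      simp only [isOPair_iff, pairMem_code, pairMem_graph, code_mem, true_and, exists_eq_left,
        code_prod, opair_inj]
      constructor
      · intro H
        ext a
        obtain ⟨a', ha', e⟩ := (H (code a) (code (f c a))).2 ⟨(c, a), ⟨rfl, rfl⟩, rfl⟩
        obtain rfl := code_inj.1 ha'
        exact code_inj.1 e
      · rintro rfl x y
        constructor
        · rintro ⟨a, rfl, rfl⟩
          exact ⟨(c, a), ⟨rfl, rfl⟩, rfl⟩
        · rintro ⟨⟨c', a⟩, ⟨h, rfl⟩, rfl⟩
          obtain rfl := code_inj.1 h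
          exact ⟨a, rfl, rfl⟩

end Inn

/-! ### Propositions -/

theorem exists_empty : ∃ e : M, ∀ x, ¬ x ∈ₘ e := by
  obtain ⟨w, ⟨z, -, hz⟩, -⟩ := (ZF.out (M := M)).infinity
  exact ⟨z, fun x hx => hz ⟨x, hx⟩⟩

variable (M) in
/-- The code of a truth value. -/
noncomputable def propCode (p : Prop) : M :=
  open Classical in if p then (exists_singleton (exists_empty (M := M)).choose).choose
    else exists_empty.choose

theorem propCode_inj : Function.Injective (propCode M) := by
  have h1 := (exists_empty (M := M)).choose_spec
  have h2 := (exists_singleton (exists_empty (M := M)).choose).choose_spec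
  have h3 : (exists_empty (M := M)).choose ≠
      (exists_singleton (exists_empty (M := M)).choose).choose := by
    intro h
    have := (h2 _).2 rfl
    rw [← h] at this
    exact h1 _ this
  intro p q h
  by_cases hp : p <;> by_cases hq : q <;> simp_all [propCode]

/-- Classically `Prop` has two elements, so a two-element set of `M` codes it. Subsets that belong
to `M` thereby become inner functions into `Prop`, and `IFun M α Prop` plays the role of the power
set. -/
noncomputable instance Code.prop : Code M Prop where
  dom := (ZF.out.pairing (propCode M True) (propCode M False)).choose
  code := propCode M
  inj := propCode_inj
  mem_dom x := by
    rw [(ZF.out.pairing (propCode M True) (propCode M False)).choose_spec]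
    constructor
    · rintro (h | h)
      · exact ⟨_, h.symm⟩
      · exact ⟨_, h.symm⟩
    · rintro ⟨p, rfl⟩
      by_cases hp : p <;> simp [hp]

theorem code_eq_true {p : Prop} : (code p : M) = code True ↔ p := by
  rw [code_inj, eq_iff_iff, iff_true]

namespace Inn

/-- A predicate is inner if it is defined by a formula. -/
theorem of_dfn_pred {P : α → Prop} (R : M → Prop) (hR : Dfn fun v : ℕ → M => R (v 0))
    (h : ∀ a, R (code a) ↔ P a) : Inn M P :=
  of_dfn (fun x t => t ∈ₘ dom Prop ∧ (R x ↔ t = code True)) (by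
    apply Dfn.and (Dfn.mem (.var _) (.par _))
    apply Dfn.iff _ (Dfn.eq (.var _) (.par _))
    exact hR) fun a b => by
    rw [h, code_eq_true, eq_iff_iff]
    simp

@[fun_prop]
theorem eq {f g : γ → α} (hf : Inn M f) (hg : Inn M g) : Inn M fun c => f c = g c := by
  have h : Inn M fun p : α × α => p.1 = p.2 :=
    of_dfn_pred (fun p => ∃ x, IsOPair p x x)
      (by repeat' first | exact .var _ | apply Dfn.ex | apply Dfn.isOPair) fun a => by
        simp only [isOPair_iff, code_prod, opair_inj]
        constructor
        · rintro ⟨_, rfl, h⟩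
          exact (code_inj.1 h).symm
        · exact fun h => ⟨_, rfl, by rw [h]⟩
  exact h.comp (hf.prodMk hg)

theorem congr_pred {P Q : α → Prop} (h : ∀ a, P a ↔ Q a) (hQ : Inn M Q) : Inn M P := by
  rwa [show P = Q from funext fun a => propext (h a)]

/-- A universal quantifier is an equation in the function type, between `P c` and the constant
`True`. Conjunction and implication also reduce to equations, so `Inn.eq` and currying generate the
logic. -/
theorem all {P : γ → α → Prop} (h : Inn M fun p : γ × α => P p.1 p.2) :
    Inn M fun c => ∀ a, P c a := by
  refine congr_pred (fun c => ?_)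
    (eq (iFunMk h h.of_curry) (const (⟨fun _ => True, const True⟩ : IFun M α Prop)))
  rw [IFun.ext_iff]
  simp

@[fun_prop]
theorem and {P Q : γ → Prop} (hP : Inn M P) (hQ : Inn M Q) : Inn M fun c => P c ∧ Q c :=
  congr_pred (fun c => by simp) (eq (hP.prodMk hQ) (const (True, True)))

theorem imp {P Q : γ → Prop} (hP : Inn M P) (hQ : Inn M Q) : Inn M fun c => P c → Q c :=
  congr_pred (fun c => by rw [eq_iff_iff]; tauto) (eq (hP.and hQ) hP)

@[fun_prop]
theorem not {P : γ → Prop} (hP : Inn M P) : Inn M fun c => ¬ P c :=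
  imp hP (const False)

@[fun_prop]
theorem or {P Q : γ → Prop} (hP : Inn M P) (hQ : Inn M Q) : Inn M fun c => P c ∨ Q c :=
  congr_pred (fun _ => or_iff_not_imp_left) (imp hP.not hQ)

@[fun_prop]
theorem iff {P Q : γ → Prop} (hP : Inn M P) (hQ : Inn M Q) : Inn M fun c => P c ↔ Q c :=
  congr_pred (fun c => by rw [eq_iff_iff]) (eq hP hQ)

@[fun_prop]
theorem ex {P : γ → α → Prop} (h : Inn M fun p : γ × α => P p.1 p.2) :
    Inn M fun c => ∃ a, P c a :=
  congr_pred (fun c => by simp) (all (P := fun c a => ¬ P c a) h.not).not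

/-- Definition by unique description. -/
theorem of_pred {f : α → β} {R : α → β → Prop} (h : Inn M fun p : α × β => R p.1 p.2)
    (hR : ∀ a b, R a b ↔ f a = b) : Inn M f :=
  of_dfn (fun x y => ∃ p, IsOPair p x y ∧ PairMem (graph M _ h) p (code True)) (by
    repeat' first
      | exact .var _ | exact .par _ | apply Dfn.and | apply Dfn.pairMem | apply Dfn.ex
      | apply Dfn.isOPair)
    fun a b => by
      simp only [isOPair_iff, pairMem_graph, exists_eq_left]
      constructor
      · rintro ⟨⟨a', b'⟩, h, h'⟩
        rw [code_prod, opair_inj, code_inj, code_inj] at h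
        obtain ⟨rfl, rfl⟩ := h
        exact (hR _ _).1 (code_eq_true.1 h'.symm)
      · rintro rfl
        exact ⟨(a, f a), rfl, (code_eq_true.2 ((hR _ _).2 rfl)).symm⟩

end Inn

/-- Rewriting with this and `imp_iff_not_or` brings a predicate into a form built from `∃`, `¬` and
`∨`, whose rules are tagged for `fun_prop`, unlike `Inn.all` and `Inn.imp`. -/
theorem forall_iff_not_exists (P : α → Prop) : (∀ a, P a) ↔ ¬ ∃ a, ¬ P a := by simp

end ZFModel

namespace ZFModel

open Code (dom code)

variable {M : Type u} [setLang.Structure M] [ZF M]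
variable {α β γ δ : Type*} [Code M α] [Code M β] [Code M γ] [Code M δ]

/-! ### Sets, subtypes and quotients -/

theorem Inn.exists_set {P : α → Prop} (h : Inn M P) :
    ∃ b : M, ∀ x, x ∈ₘ b ↔ ∃ a, P a ∧ x = code a := by
  obtain ⟨b, hb⟩ := exists_sep (fun x => PairMem (graph M P h) x (code True))
    (Dfn.pairMem (.par _) (.var _) (.par _)) (dom α)
  refine ⟨b, fun x => ?_⟩
  rw [hb]
  simp only [pairMem_graph, Code.mem_dom, eq_comm (a := (code True : M)), code_eq_true]
  constructor
  · rintro ⟨-, a, rfl, h⟩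
    exact ⟨a, h, rfl⟩
  · rintro ⟨a, h, rfl⟩
    exact ⟨⟨a, rfl⟩, a, rfl, h⟩

theorem Inn.of_exists_set {P : α → Prop} (b : M) (h : ∀ a, code a ∈ₘ b ↔ P a) : Inn M P :=
  .of_dfn_pred (fun x => x ∈ₘ b) (Dfn.mem (.var _) (.par _)) h

instance Code.el (a : M) : Code M (El a) where
  dom := a
  code x := x.1
  inj := Subtype.val_injective
  mem_dom x := ⟨fun h => ⟨⟨x, h⟩, rfl⟩, fun ⟨y, h⟩ => h ▸ y.2⟩

/-- The codes of the images under an injection with inner range. -/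
@[reducible]
noncomputable def Code.ofInj (j : δ → α) (hj : Function.Injective j)
    (h : Inn M fun a => ∃ d, j d = a) : Code M δ where
  dom := h.exists_set.choose
  code d := code (j d)
  inj := Code.inj.comp hj
  mem_dom x := by
    rw [h.exists_set.choose_spec]
    constructor
    · rintro ⟨_, ⟨d, rfl⟩, rfl⟩
      exact ⟨d, rfl⟩
    · rintro ⟨d, rfl⟩
      exact ⟨_, ⟨d, rfl⟩, rfl⟩

/-- The graph of `f` is the image of that of `g`. Operations on the quotients `QQ M` and `RR M` are
shown to be inner through their effect on representatives. -/
theorem Inn.of_comp_surj {π : α → β} (hπ : Inn M π) (hs : Function.Surjective π) {f : β → γ}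
    {g : α → γ} (hg : Inn M g) (h : ∀ a, f (π a) = g a) : Inn M f := by
  refine .of_pred (R := fun b c => ∃ a, π a = b ∧ g a = c) (by fun_prop) fun b c => ?_
  obtain ⟨a, rfl⟩ := hs b
  constructor
  · rintro ⟨a', h', rfl⟩
    rw [← h', h]
  · rintro rfl
    exact ⟨a, rfl, (h a).symm⟩

theorem Inn.of_comp_surj₂ {π : α → β} (hπ : Inn M π) (hs : Function.Surjective π)
    {f : β → β → γ} {g : α → α → γ} (hg : Inn M fun p : α × α => g p.1 p.2)
    (h : ∀ a b, f (π a) (π b) = g a b) : Inn M fun p : β × β => f p.1 p.2 :=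
  of_comp_surj (π := fun p : α × α => (π p.1, π p.2)) (by fun_prop)
    (fun p => (hs p.1).elim fun a ha => (hs p.2).elim fun b hb => ⟨(a, b), Prod.ext ha hb⟩) hg
    fun p => h p.1 p.2

/-- The quotient by the kernel of a surjection, if the kernel is inner. -/
@[reducible]
noncomputable def Code.ofSurj (π : α → δ) (hπ : Function.Surjective π)
    (h : Inn M fun p : α × α => π p.1 = π p.2) : Code M δ :=
  .ofInj (α := IFun M α Prop)
    (fun d => ⟨fun a => π a = d, by
      obtain ⟨a, rfl⟩ := hπ d
      exact h.comp (Inn.id.prodMk (Inn.const a))⟩)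
    (fun d d' e => by
      obtain ⟨a, rfl⟩ := hπ d
      have := congrArg (fun f => IFun.app f a) e
      simpa using this)
    (.congr_pred (Q := fun S => ∃ a, S = ⟨fun a' => π a' = π a,
        h.comp (Inn.id.prodMk (Inn.const a))⟩) (fun S => by
      constructor
      · rintro ⟨d, rfl⟩
        obtain ⟨a, rfl⟩ := hπ d
        exact ⟨a, rfl⟩
      · rintro ⟨a, rfl⟩
        exact ⟨π a, rfl⟩) (by
      refine Inn.ex (.eq (by fun_prop) (.iFunMk ?_ _))
      exact h.comp (by fun_prop : Inn M fun p : (IFun M α Prop × α) × α => (p.2, p.1.2))))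

theorem Inn.proj (π : α → δ) (hπ : Function.Surjective π)
    (h : Inn M fun p : α × α => π p.1 = π p.2) :
    letI := Code.ofSurj π hπ h
    Inn M π :=
  Inn.iFunMk (f := fun a a' => π a' = π a)
    (h.comp (by fun_prop : Inn M fun p : α × α => (p.2, p.1))) fun a =>
      h.comp (Inn.id.prodMk (Inn.const a))

/-! ### Natural numbers -/

/-- The intersection of all inductive sets, separated from one of them. It is inductive because the
empty set and successors are unique by extensionality. -/
theorem exists_omega : ∃ w : M, IsOmega w := by
  obtain ⟨w, hw⟩ := (ZF.out (M := M)).infinity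
  obtain ⟨o, ho⟩ := exists_sep (fun x => ∀ v, IsInductive v → x ∈ₘ v) (by
    unfold IsInductive Inhab IsSucc
    repeat' first
      | exact .var _ | exact .par _ | apply Dfn.mem | apply Dfn.eq | apply Dfn.and | apply Dfn.or
      | apply Dfn.not | apply Dfn.iff | apply Dfn.imp | apply Dfn.ex | apply Dfn.all) w
  refine ⟨o, ⟨?_, fun n hn => ?_⟩, fun v hv x hx => ((ho x).1 hx).2 v hv⟩
  · obtain ⟨z, hz, hz'⟩ := hw.1
    refine ⟨z, (ho z).2 ⟨hz, fun v hv => ?_⟩, hz'⟩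
    obtain ⟨y, hy, hy'⟩ := hv.1
    rwa [show z = y from ext_mem fun x => iff_of_false (fun h => hz' ⟨x, h⟩) fun h => hy' ⟨x, h⟩]
  · obtain ⟨hn, hn'⟩ := (ho n).1 hn
    obtain ⟨s, hs, hs'⟩ := hw.2 n hn
    refine ⟨s, (ho s).2 ⟨hs, fun v hv => ?_⟩, hs'⟩
    obtain ⟨t, ht, ht'⟩ := hv.2 n (hn' v hv)
    rwa [show s = t from ext_mem fun x => (hs' x).trans (ht' x).symm]

theorem IsOmega.eq {w w' : M} (h : IsOmega w) (h' : IsOmega w') : w = w' :=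
  ext_mem fun _ => ⟨h.2 _ h'.1 _, h'.2 _ h.1 _⟩

variable (M) in
/-- The set of natural numbers of `M`. -/
noncomputable def omega : M := exists_omega.choose

theorem isOmega_omega : IsOmega (omega M) := exists_omega.choose_spec

variable (M) in
/-- The natural numbers of `M`. -/
abbrev NN : Type u := El (omega M)

namespace NN

noncomputable instance : Zero (NN M) := ⟨⟨_, isOmega_omega.1.1.choose_spec.1⟩⟩

theorem not_mem_zero (x : M) : ¬ x ∈ₘ (0 : NN M).1 :=
  fun h => isOmega_omega.1.1.choose_spec.2 ⟨x, h⟩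

/-- The successor. -/
noncomputable def succ (n : NN M) : NN M := ⟨_, (isOmega_omega.1.2 n.1 n.2).choose_spec.1⟩

theorem mem_succ {n : NN M} {x : M} : x ∈ₘ n.succ.1 ↔ x ∈ₘ n.1 ∨ x = n.1 :=
  (isOmega_omega.1.2 n.1 n.2).choose_spec.2 x

@[fun_prop]
theorem inn_succ : Inn M (succ (M := M)) :=
  .of_dfn (fun n s => IsSucc s n) (by
    unfold IsSucc
    repeat' first
      | exact .var _ | apply Dfn.mem | apply Dfn.eq | apply Dfn.or | apply Dfn.iff
      | apply Dfn.all) fun a b => by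
    constructor
    · exact fun h => Subtype.ext (ext_mem fun x => mem_succ.trans (h x).symm)
    · rintro rfl x
      exact mem_succ

/-- The minimality of `ω` concerns only inductive sets of `M`, so `P` has to be inner: `NN M` may be
nonstandard. This is why each later induction has a goal `hP`. -/
theorem induct {P : NN M → Prop} (hP : Inn M P) (h0 : P 0) (hs : ∀ n, P n → P n.succ) (n : NN M) :
    P n := by
  obtain ⟨v, hv⟩ := hP.exists_set
  have : IsInductive v := by
    refine ⟨⟨_, (hv _).2 ⟨0, h0, rfl⟩, fun ⟨x, hx⟩ => not_mem_zero x hx⟩, fun n hn => ?_⟩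
    obtain ⟨n, hn', rfl⟩ := (hv _).1 hn
    exact ⟨_, (hv _).2 ⟨n.succ, hs n hn', rfl⟩, fun x => mem_succ⟩
  obtain ⟨m, hm, h⟩ := (hv _).1 (isOmega_omega.2 v this n.1 n.2)
  rwa [Subtype.ext h]

theorem succ_ne_zero (n : NN M) : n.succ ≠ 0 := fun h =>
  not_mem_zero n.1 (h ▸ mem_succ.2 (.inr rfl))

/-- Distinct numbers with the same successor would be elements of each other, which foundation for
`{m, n}` excludes. -/
theorem succ_inj {m n : NN M} (h : m.succ = n.succ) : m = n := by
  by_contra hne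
  have hne' : m.1 ≠ n.1 := fun h => hne (Subtype.ext h)
  have h1 : m.1 ∈ₘ n.1 :=
    (mem_succ.1 (h ▸ mem_succ.2 (.inr rfl) : m.1 ∈ₘ n.succ.1)).resolve_right hne'
  have h2 : n.1 ∈ₘ m.1 :=
    (mem_succ.1 (h ▸ mem_succ.2 (.inr rfl) : n.1 ∈ₘ m.succ.1)).resolve_right hne'.symm
  obtain ⟨c, hc⟩ := ZF.out.pairing m.1 n.1
  obtain ⟨x, hx, hx'⟩ := ZF.out.foundation c ⟨m.1, (hc _).2 (.inl rfl)⟩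
  rcases (hc x).1 hx with rfl | rfl
  · exact hx' _ ((hc _).2 (.inr rfl)) h2
  · exact hx' _ ((hc _).2 (.inl rfl)) h1

/-- The graph is the least set of `M` containing `(0, a)` and closed under `(n, x) ↦ (n + 1, g x)`.
As an intersection over sets of `M` it is inner, and induction shows that it is functional. -/
theorem exists_rec (a : α) (g : α → α) (hg : Inn M g) :
    ∃ f : NN M → α, Inn M f ∧ f 0 = a ∧ ∀ n, f n.succ = g (f n) := by
  let R : NN M → α → Prop := fun n x => ∀ G : IFun M (NN M × α) Prop, G.app (0, a) →
    (∀ n x, G.app (n, x) → G.app (n.succ, g x)) → G.app (n, x)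
  have hR : Inn M fun p : NN M × α => R p.1 p.2 := by
    simp only [R, forall_iff_not_exists, imp_iff_not_or]
    fun_prop
  have h0 : R 0 a := fun G h _ => h
  have hs : ∀ n x, R n x → R n.succ (g x) := fun n x h G h1 h2 => h2 _ _ (h G h1 h2)
  have hR' (n : NN M) : Inn M (R n) := Inn.of_curry hR n
  -- For both inversion rules, `R` is compared with the closed set obtained from it by imposing the
  -- desired conclusion on the relevant pairs.
  have inv0 : ∀ x, R 0 x → x = a := fun x hx => by
    have := hx ⟨fun p => R p.1 p.2 ∧ (p.1 = 0 → p.2 = a), by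
      simp only [imp_iff_not_or]
      fun_prop⟩ ⟨h0, fun _ => rfl⟩ fun n x h => ⟨hs _ _ h.1, fun h => (succ_ne_zero n h).elim⟩
    exact this.2 rfl
  have invs : ∀ n x, R n.succ x → ∃ y, R n y ∧ x = g y := fun n x hx => by
    have := hx ⟨fun p => R p.1 p.2 ∧ (p.1 = n.succ → ∃ y, R n y ∧ p.2 = g y), by
      simp only [imp_iff_not_or]
      fun_prop⟩ ⟨h0, fun h => (succ_ne_zero n h.symm).elim⟩ fun m x h =>
        ⟨hs _ _ h.1, fun e => ⟨x, succ_inj e ▸ h.1, rfl⟩⟩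
    exact this.2 rfl
  have hex : ∀ n, ∃ x, ∀ y, R n y ↔ y = x := by
    refine induct ?_ ⟨a, fun y => ⟨inv0 y, fun h => h ▸ h0⟩⟩ ?_
    · simp only [forall_iff_not_exists]
      fun_prop
    · rintro n ⟨x, hx⟩
      refine ⟨g x, fun y => ⟨fun h => ?_, fun h => h ▸ hs _ _ ((hx x).2 rfl)⟩⟩
      obtain ⟨z, hz, rfl⟩ := invs n y h
      rw [(hx z).1 hz]
  choose f hf using hex
  refine ⟨f, .of_pred hR fun n x => (hf n x).trans eq_comm, ((hf 0 a).1 h0).symm, fun n => ?_⟩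
  exact ((hf _ _).1 (hs _ _ ((hf n _).2 rfl))).symm

end NN

end ZFModel

/-! ### Arithmetic of the natural numbers of `M`. -/

namespace ZFModel

open Code (dom code)

variable {M : Type u} [setLang.Structure M] [ZF M]
variable {α β γ δ : Type*} [Code M α] [Code M β] [Code M γ] [Code M δ]

namespace NN

-- Addition is a recursion on one summand with values in the function type, which carries the other
-- summand as a parameter. Multiplication is obtained in the same way.
variable (M) in
theorem exists_add : ∃ f : NN M → IFun M (NN M) (NN M), Inn M f ∧ (∀ m, (f 0).app m = m) ∧
    ∀ n m, (f n.succ).app m = ((f n).app m).succ := by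
  obtain ⟨f, hf, h0, hs⟩ := exists_rec (M := M) (⟨fun m => m, .id⟩ : IFun M (NN M) (NN M))
    (fun h => ⟨fun m => (h.app m).succ, by fun_prop⟩) (by fun_prop)
  exact ⟨f, hf, fun m => by simp [h0], fun n m => by simp [hs]⟩

noncomputable instance : Add (NN M) := ⟨fun m n => ((exists_add M).choose n).app m⟩

@[fun_prop]
theorem inn_add {f g : α → NN M} (hf : Inn M f) (hg : Inn M g) : Inn M fun a => f a + g a := by
  have := (exists_add M).choose_spec.1
  change Inn M fun a => ((exists_add M).choose (g a)).app (f a)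
  fun_prop

theorem add_zero' (m : NN M) : m + 0 = m := (exists_add M).choose_spec.2.1 m

theorem add_succ (m n : NN M) : m + n.succ = (m + n).succ := (exists_add M).choose_spec.2.2 n m

theorem zero_add' (m : NN M) : 0 + m = m := by
  induction m using induct with
  | hP => fun_prop
  | h0 => rw [add_zero']
  | hs n ih => rw [add_succ, ih]

theorem succ_add (m n : NN M) : m.succ + n = (m + n).succ := by
  induction n using induct with
  | hP => fun_prop
  | h0 => rw [add_zero', add_zero']
  | hs n ih => rw [add_succ, ih, add_succ]

variable (M) in
theorem exists_mul : ∃ f : NN M → IFun M (NN M) (NN M), Inn M f ∧ (∀ m, (f 0).app m = 0) ∧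
    ∀ n m, (f n.succ).app m = (f n).app m + m := by
  obtain ⟨f, hf, h0, hs⟩ := exists_rec (M := M) (⟨fun m => 0, .const 0⟩ : IFun M (NN M) (NN M))
    (fun h => ⟨fun m => h.app m + m, by fun_prop⟩) (by fun_prop)
  exact ⟨f, hf, fun m => by simp [h0], fun n m => by simp [hs]⟩

noncomputable instance : Mul (NN M) := ⟨fun m n => ((exists_mul M).choose n).app m⟩

@[fun_prop]
theorem inn_mul {f g : α → NN M} (hf : Inn M f) (hg : Inn M g) : Inn M fun a => f a * g a := by
  have := (exists_mul M).choose_spec.1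
  change Inn M fun a => ((exists_mul M).choose (g a)).app (f a)
  fun_prop

theorem mul_zero' (m : NN M) : m * 0 = 0 := (exists_mul M).choose_spec.2.1 m

theorem mul_succ (m n : NN M) : m * n.succ = m * n + m := (exists_mul M).choose_spec.2.2 n m

noncomputable instance : AddCommMonoid (NN M) where
  add_assoc a b c := by
    induction c using induct with
    | hP => fun_prop
    | h0 => rw [add_zero', add_zero']
    | hs n ih => rw [add_succ, add_succ, add_succ, ih]
  zero_add := zero_add'
  add_zero := add_zero'
  add_comm a b := by
    induction b using induct with
    | hP => fun_prop
    | h0 => rw [add_zero', zero_add']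
    | hs n ih => rw [add_succ, succ_add, ih]
  nsmul := nsmulRec

noncomputable instance : One (NN M) := ⟨succ 0⟩

theorem succ_eq (n : NN M) : n.succ = n + 1 := by
  change _ = n + succ 0
  rw [add_succ, add_zero']

theorem zero_mul' (m : NN M) : 0 * m = 0 := by
  induction m using induct with
  | hP => fun_prop
  | h0 => rw [mul_zero']
  | hs n ih => rw [mul_succ, ih, add_zero]

theorem succ_mul (m n : NN M) : m.succ * n = m * n + n := by
  induction n using induct with
  | hP => fun_prop
  | h0 => simp [mul_zero']
  | hs n ih => rw [mul_succ, mul_succ, ih, succ_eq m, succ_eq n]; ac_rfl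

theorem mul_comm' (m n : NN M) : m * n = n * m := by
  induction n using induct with
  | hP => fun_prop
  | h0 => rw [mul_zero', zero_mul']
  | hs n ih => rw [mul_succ, succ_mul, ih]

theorem mul_add' (a b c : NN M) : a * (b + c) = a * b + a * c := by
  induction c using induct with
  | hP => fun_prop
  | h0 => rw [mul_zero', add_zero, add_zero]
  | hs n ih => rw [mul_succ, add_succ, mul_succ, ih, add_assoc]

noncomputable instance : CommSemiring (NN M) where
  zero_mul := zero_mul'
  mul_zero := mul_zero'
  mul_comm := mul_comm'
  left_distrib := mul_add'
  right_distrib a b c := by rw [mul_comm', mul_add', mul_comm', mul_comm' c]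
  mul_assoc a b c := by
    induction c using induct with
    | hP => fun_prop
    | h0 => simp [mul_zero']
    | hs n ih => rw [mul_succ, mul_succ, mul_add', ih]
  one_mul a := by
    rw [mul_comm']
    exact (mul_succ a 0).trans (by rw [mul_zero', zero_add'])
  mul_one a := (mul_succ a 0).trans (by rw [mul_zero', zero_add'])

theorem induction {P : NN M → Prop} (hP : Inn M P) (h0 : P 0) (hs : ∀ n, P n → P (n + 1))
    (n : NN M) : P n :=
  induct hP h0 (fun n h => succ_eq n ▸ hs n h) n

theorem add_one_ne_zero (n : NN M) : n + 1 ≠ 0 := succ_eq n ▸ succ_ne_zero n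

theorem add_one_inj {m n : NN M} (h : m + 1 = n + 1) : m = n :=
  succ_inj (by rwa [succ_eq, succ_eq])

theorem eq_zero_or_succ (n : NN M) : n = 0 ∨ ∃ m, n = m + 1 := by
  induction n using induction with
  | hP => fun_prop
  | h0 => exact .inl rfl
  | hs n ih => exact .inr ⟨n, rfl⟩

instance : IsCancelAdd (NN M) :=
  have : IsRightCancelAdd (NN M) := ⟨fun c a b => by
    change a + c = b + c → a = b
    induction c using induction with
    | hP =>
      simp only [imp_iff_not_or]
      fun_prop
    | h0 => simp
    | hs n ih => exact fun h => ih (add_one_inj (by simpa only [add_assoc] using h))⟩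
  AddCommMagma.IsRightCancelAdd.toIsCancelAdd _

theorem add_eq_zero' {m n : NN M} (h : m + n = 0) : m = 0 := by
  rcases eq_zero_or_succ m with h' | ⟨k, rfl⟩
  · exact h'
  · rw [add_right_comm] at h
    exact (add_one_ne_zero _ h).elim

theorem total (m n : NN M) : (∃ k, m + k = n) ∨ ∃ k, n + k = m := by
  induction n using induction with
  | hP => fun_prop
  | h0 => exact .inr ⟨m, by simp⟩
  | hs n ih =>
    rcases ih with ⟨k, rfl⟩ | ⟨k, rfl⟩
    · exact .inl ⟨k + 1, by rw [add_assoc]⟩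
    · rcases eq_zero_or_succ k with rfl | ⟨k, rfl⟩
      · exact .inl ⟨1, by simp⟩
      · exact .inr ⟨k, by ac_rfl⟩

noncomputable instance : LinearOrder (NN M) where
  le m n := ∃ k, m + k = n
  le_refl m := ⟨0, add_zero m⟩
  le_trans := by
    rintro a _ _ ⟨k, rfl⟩ ⟨l, rfl⟩
    exact ⟨k + l, by rw [add_assoc]⟩
  le_antisymm := by
    rintro a _ ⟨k, rfl⟩ ⟨l, h⟩
    have h' : k + l = 0 := by
      rw [add_assoc] at h
      exact add_eq_left.1 h
    rw [add_eq_zero' h', add_zero]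
  le_total := total
  toDecidableLE := Classical.decRel _

theorem le_def {m n : NN M} : m ≤ n ↔ ∃ k, m + k = n := Iff.rfl

@[fun_prop]
theorem inn_le {f g : α → NN M} (hf : Inn M f) (hg : Inn M g) : Inn M fun a => f a ≤ g a := by
  simp only [le_def]
  fun_prop

@[fun_prop]
theorem inn_lt {f g : α → NN M} (hf : Inn M f) (hg : Inn M g) : Inn M fun a => f a < g a := by
  simp only [← not_le]
  fun_prop

theorem lt_add_one_iff {m n : NN M} : m < n + 1 ↔ m ≤ n := by
  constructor
  · intro h
    by_contra! h'
    have hne := h'.ne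
    obtain ⟨k, rfl⟩ := h'.le
    rcases eq_zero_or_succ k with rfl | ⟨k, rfl⟩
    · simp at hne
    · exact not_le.2 h ⟨k, by ac_rfl⟩
  · rintro ⟨k, rfl⟩
    by_contra! h
    obtain ⟨l, hl⟩ := h
    rw [add_assoc, add_assoc, add_eq_left] at hl
    exact add_one_ne_zero (k + l) (by rw [← hl]; ac_rfl)

theorem zero_le' (n : NN M) : 0 ≤ n := ⟨n, zero_add n⟩

theorem mem_iff_lt {m n : NN M} : m.1 ∈ₘ n.1 ↔ m < n := by
  induction n using induct with
  | hP =>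
    refine .iff ?_ (by fun_prop)
    exact .of_dfn_pred (fun x => m.1 ∈ₘ x) (Dfn.mem (.par _) (.var _)) fun a => Iff.rfl
  | h0 => exact iff_of_false (not_mem_zero _) (not_lt.2 (zero_le' m))
  | hs n ih =>
    rw [mem_succ, succ_eq, lt_add_one_iff, le_iff_lt_or_eq, ih]
    exact or_congr_right Subtype.ext_iff.symm

theorem natLE_iff {m n : NN M} : NatLE m n ↔ m ≤ n := by
  rw [NatLE, mem_iff_lt, le_iff_lt_or_eq]

instance : NoZeroDivisors (NN M) where
  eq_zero_or_eq_zero_of_mul_eq_zero {a b} h := by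
    rcases eq_zero_or_succ a with rfl | ⟨k, rfl⟩
    · exact .inl rfl
    · rw [add_mul, one_mul, add_comm] at h
      exact .inr (add_eq_zero' h)

instance : Nontrivial (NN M) := ⟨0, 1, fun h => add_one_ne_zero 0 (by rw [zero_add, h])⟩

theorem strong_induction {P : NN M → Prop} (hP : Inn M P) (h : ∀ n, (∀ m < n, P m) → P n)
    (n : NN M) : P n := by
  have : ∀ m < n, P m := by
    induction n using induction with
    | hP =>
      simp only [forall_iff_not_exists, imp_iff_not_or]
      fun_prop
    | h0 => exact fun m hm => (not_le.2 hm (zero_le' m)).elim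
    | hs n ih =>
      intro m hm
      rcases (lt_add_one_iff.1 hm).lt_or_eq with h' | rfl
      · exact ih m h'
      · exact h m ih
  exact h n this

theorem exists_least {P : NN M → Prop} (hP : Inn M P) (h : ∃ n, P n) :
    ∃ n, P n ∧ ∀ m, P m → n ≤ m := by
  by_contra! H
  obtain ⟨n, hn⟩ := h
  have : ¬ P n := by
    refine strong_induction (P := fun n => ¬ P n) hP.not (fun n ih hn => ?_) n
    obtain ⟨m, hm, hm'⟩ := H n hn
    exact ih m hm' hm
  exact this hn

end NN

end ZFModel

namespace ZFModel

open Code (dom code)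

variable {M : Type u} [setLang.Structure M] [ZF M]
variable {α β γ δ : Type*} [Code M α] [Code M β] [Code M γ] [Code M δ]

/-! ### Ordered fields from their nonnegative elements -/

/-- `P` is the set of nonnegative elements for a linear order of the field `K`. -/
structure IsNonnegCone {K : Type*} [Field K] (P : K → Prop) : Prop where
  add : ∀ {x y}, P x → P y → P (x + y)
  mul : ∀ {x y}, P x → P y → P (x * y)
  total : ∀ x, P x ∨ P (-x)
  eq_zero : ∀ {x}, P x → P (-x) → x = 0

namespace IsNonnegCone

variable {K : Type*} [Field K] {P : K → Prop}

/-- The linear order with given nonnegative elements. -/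
@[reducible]
noncomputable def linearOrder (h : IsNonnegCone P) : LinearOrder K where
  le a b := P (b - a)
  le_refl a := by simpa using h.total 0
  le_trans a b c h1 h2 := by simpa using h.add h2 h1
  le_antisymm a b h1 h2 := (sub_eq_zero.1 (h.eq_zero h1 (by simpa using h2))).symm
  le_total a b := by simpa using h.total (b - a)
  toDecidableLE := Classical.decRel _

theorem isStrictOrderedRing (h : IsNonnegCone P) :
    let _ := h.linearOrder
    IsStrictOrderedRing K := by
  let _ := h.linearOrder
  have hle {a b : K} : a ≤ b ↔ P (b - a) := Iff.rfl
  have : IsOrderedAddMonoid K :=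
    { add_le_add_left := fun a b hab c => by
        rw [hle] at hab ⊢
        simpa using hab }
  have : ZeroLEOneClass K := ⟨by
    rw [hle]
    rcases h.total 1 with h1 | h1
    · simpa using h1
    · simpa using h.mul h1 h1⟩
  have : IsOrderedRing K := .of_mul_nonneg fun x y hx hy => by
    rw [hle] at *
    simpa using h.mul (by simpa using hx) (by simpa using hy)
  exact IsOrderedRing.toIsStrictOrderedRing K

end IsNonnegCone

/-! ### The ring completion of a commutative semiring -/

/-- The ring completion of a commutative semiring. -/
def RingCompletion (N : Type*) [CommSemiring N] := Algebra.GrothendieckAddGroup N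

namespace RingCompletion

variable {N : Type*} [CommSemiring N]

noncomputable instance : AddCommGroup (RingCompletion N) :=
  inferInstanceAs (AddCommGroup (Algebra.GrothendieckAddGroup N))

/-- The canonical map, as an additive homomorphism. -/
def ofAdd : N →+ RingCompletion N := Algebra.GrothendieckAddGroup.of

/-- The extension of an additive homomorphism. -/
noncomputable def lift {G : Type*} [AddCommGroup G] (f : N →+ G) : RingCompletion N →+ G :=
  Algebra.GrothendieckAddGroup.lift f

@[simp] theorem lift_ofAdd {G : Type*} [AddCommGroup G] (f : N →+ G) (n : N) :
    lift f (ofAdd n) = f n :=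
  DFunLike.congr_fun (Algebra.GrothendieckAddGroup.lift.symm_apply_apply f) n

theorem hom_ext {G : Type*} [AddCommGroup G] {f g : RingCompletion N →+ G}
    (h : ∀ n, f (ofAdd n) = g (ofAdd n)) : f = g :=
  Algebra.GrothendieckAddGroup.lift.symm.injective (AddMonoidHom.ext h)

theorem induction {P : RingCompletion N → Prop} (h : ∀ n, P (ofAdd n))
    (h' : ∀ x y, P x → P y → P (x - y)) (x : RingCompletion N) : P x := by
  have : ∀ y : Algebra.GrothendieckAddGroup N, P y := fun y => by
    induction y using AddLocalization.ind with
    | _ y =>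
      have : AddLocalization.mk y.1 y.2 =
          Algebra.GrothendieckAddGroup.of y.1 - Algebra.GrothendieckAddGroup.of y.2.1 := by
        change _ = AddLocalization.mk y.1 0 - AddLocalization.mk y.2.1 0
        rw [Algebra.GrothendieckAddGroup.mk_sub_mk]
        simp
      rw [this]
      exact h' _ _ (h _) (h _)
  exact this x

theorem exists_eq_sub (x : RingCompletion N) : ∃ a b, x = ofAdd a - ofAdd b := by
  induction x using induction with
  | h n => exact ⟨n, 0, by simp⟩
  | h' x y hx hy =>
    obtain ⟨a, b, rfl⟩ := hx
    obtain ⟨c, d, rfl⟩ := hy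
    exact ⟨a + d, b + c, by simp only [map_add]; abel⟩

theorem ofAdd_injective [IsCancelAdd N] : Function.Injective (ofAdd (N := N)) :=
  Algebra.GrothendieckAddGroup.of_injective

/-- The multiplication as a biadditive map. -/
noncomputable def mulHom : RingCompletion N →+ RingCompletion N →+ RingCompletion N :=
  lift
    { toFun n := lift (ofAdd.comp (AddMonoidHom.mulLeft n))
      map_zero' := hom_ext fun n => by simp
      map_add' a b := hom_ext fun n => by simp [add_mul] }

noncomputable instance : Mul (RingCompletion N) := ⟨fun x y => mulHom x y⟩

theorem mul_def (x y : RingCompletion N) : x * y = mulHom x y := rfl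

theorem ofAdd_mul (a b : N) : ofAdd (a * b) = ofAdd a * ofAdd b := by
  simp [mul_def, mulHom]

theorem sub_mul' (x y z : RingCompletion N) : (x - y) * z = x * z - y * z := by
  simp [mul_def]

theorem mul_sub' (x y z : RingCompletion N) : x * (y - z) = x * y - x * z := by
  simp [mul_def]

theorem mul_comm' (x y : RingCompletion N) : x * y = y * x := by
  induction x using induction with
  | h a =>
    induction y using induction with
    | h b => rw [← ofAdd_mul, ← ofAdd_mul, mul_comm]
    | h' y z hy hz => rw [mul_sub', sub_mul', hy, hz]
  | h' x z hx hz => rw [mul_sub', sub_mul', hx, hz]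

noncomputable instance : One (RingCompletion N) := ⟨ofAdd 1⟩

theorem one_mul' (x : RingCompletion N) : 1 * x = x := by
  change ofAdd 1 * x = x
  induction x using induction with
  | h a => rw [← ofAdd_mul, one_mul]
  | h' x z hx hz => rw [mul_sub', hx, hz]

noncomputable instance : CommRing (RingCompletion N) where
  __ := (inferInstance : AddCommGroup (RingCompletion N))
  zero_mul x := by simp [mul_def]
  mul_zero x := by simp [mul_def]
  left_distrib x y z := by simp [mul_def]
  right_distrib x y z := by simp [mul_def]
  mul_comm := mul_comm'
  one_mul := one_mul'
  mul_one x := by rw [mul_comm', one_mul']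
  mul_assoc x y z := by
    induction x using induction with
    | h' x x' hx hx' => simp only [sub_mul', hx, hx']
    | h a =>
      induction y using induction with
      | h' x x' hx hx' => simp only [sub_mul', mul_sub', hx, hx']
      | h b =>
        induction z using induction with
        | h' x x' hx hx' => simp only [mul_sub', hx, hx']
        | h c => simp only [← ofAdd_mul, mul_assoc]

/-- The canonical ring homomorphism. -/
noncomputable def of : N →+* RingCompletion N where
  toFun := ofAdd
  map_zero' := map_zero _
  map_add' := map_add _
  map_one' := rfl
  map_mul' := ofAdd_mul

end RingCompletion

/-! ### Rational numbers -/

variable (M) in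
/-- The integers of `M`. -/
abbrev ZZ : Type u := RingCompletion (NN M)

namespace ZZ

/-- The inclusion of the natural numbers. -/
noncomputable def of : NN M →+* ZZ M := RingCompletion.of

theorem of_injective : Function.Injective (of (M := M)) := RingCompletion.ofAdd_injective

theorem exists_eq_or_neg (x : ZZ M) : ∃ n, x = of n ∨ x = -of n := by
  obtain ⟨a, b, rfl⟩ := RingCompletion.exists_eq_sub x
  change ∃ n, of a - of b = _ ∨ of a - of b = _
  rcases NN.total a b with ⟨k, rfl⟩ | ⟨k, rfl⟩
  · exact ⟨k, .inr (by simp)⟩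
  · exact ⟨k, .inl (by simp)⟩

instance : Nontrivial (ZZ M) := of_injective.nontrivial

instance : IsDomain (ZZ M) :=
  have : NoZeroDivisors (ZZ M) := ⟨fun {x y} h => by
    have hz (n : NN M) : of n = 0 → n = 0 := fun h => of_injective (by simpa using h)
    have hm (m n : NN M) (h : of m * of n = 0) : m = 0 ∨ n = 0 := by
      rw [← map_mul] at h
      exact mul_eq_zero.1 (hz _ h)
    obtain ⟨m, hx⟩ := exists_eq_or_neg x
    obtain ⟨n, hy⟩ := exists_eq_or_neg y
    rcases hx with rfl | rfl <;> rcases hy with rfl | rfl <;>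
      (try simp only [neg_mul, mul_neg, neg_eq_zero, neg_neg] at h) <;>
      rcases hm m n h with rfl | rfl <;> simp⟩
  NoZeroDivisors.to_isDomain _

end ZZ

variable (M) in
/-- The rational numbers of `M`. -/
def QQ : Type u := FractionRing (ZZ M)

namespace QQ

noncomputable instance instField : Field (QQ M) := inferInstanceAs (Field (FractionRing (ZZ M)))

/-- The inclusion of the integers. -/
noncomputable def ofZZ : ZZ M →+* QQ M := algebraMap (ZZ M) (FractionRing (ZZ M))

/-- The inclusion of the natural numbers. -/
noncomputable def of : NN M →+* QQ M := ofZZ.comp ZZ.of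

theorem of_injective : Function.Injective (of (M := M)) :=
  (IsFractionRing.injective (ZZ M) (FractionRing (ZZ M))).comp ZZ.of_injective

theorem ofZZ_div_surjective (q : QQ M) : ∃ x y, y ≠ 0 ∧ ofZZ x / ofZZ y = q := by
  obtain ⟨x, y, hy, h⟩ := IsFractionRing.div_surjective (A := ZZ M) (K := FractionRing (ZZ M)) q
  exact ⟨x, y, nonZeroDivisors.ne_zero hy, h⟩

attribute [irreducible] instField

theorem of_succ_ne_zero (n : NN M) : of n + 1 ≠ 0 := fun h =>
  NN.add_one_ne_zero n (of_injective (by simpa using h))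

theorem exists_eq_div (q : QQ M) : ∃ n c, q = of n / (of c + 1) ∨ q = -(of n / (of c + 1)) := by
  obtain ⟨x, y, hy', h⟩ := ofZZ_div_surjective q
  obtain ⟨m, hx⟩ := ZZ.exists_eq_or_neg x
  obtain ⟨n, hy⟩ := ZZ.exists_eq_or_neg y
  rcases NN.eq_zero_or_succ n with rfl | ⟨c, rfl⟩
  · simp [hy'] at hy
  have hc : ofZZ (ZZ.of (c + 1)) = (of c + 1 : QQ M) := by
    rw [map_add, map_one, map_add, map_one]
    rfl
  refine ⟨m, c, ?_⟩
  have hm : ofZZ (ZZ.of m) = (of m : QQ M) := rfl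
  rcases hx with rfl | rfl <;> rcases hy with rfl | rfl <;>
    simp only [map_neg, neg_div, div_neg, neg_neg, hc, hm] at h
  · exact .inl h.symm
  · exact .inr h.symm
  · exact .inr h.symm
  · exact .inl h.symm

attribute [irreducible] ofZZ of

theorem isNonnegCone : IsNonnegCone fun q : QQ M => ∃ n c, q = of n / (of c + 1) where
  add := by
    rintro _ _ ⟨a, b, rfl⟩ ⟨c, d, rfl⟩
    -- Denominators are stored minus one: `(b + 1) * (d + 1) = (b * d + b + d) + 1`.
    refine ⟨a * (d + 1) + c * (b + 1), b * d + b + d, ?_⟩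
    have hb := of_succ_ne_zero b
    have hd := of_succ_ne_zero d
    have h := of_succ_ne_zero (b * d + b + d)
    rw [div_add_div _ _ hb hd, div_eq_div_iff (mul_ne_zero hb hd) h]
    simp only [map_add, map_mul, map_one]
    ring
  mul := by
    rintro _ _ ⟨a, b, rfl⟩ ⟨c, d, rfl⟩
    refine ⟨a * c, b * d + b + d, ?_⟩
    have hb := of_succ_ne_zero b
    have hd := of_succ_ne_zero d
    have h := of_succ_ne_zero (b * d + b + d)
    rw [div_mul_div_comm, div_eq_div_iff (mul_ne_zero hb hd) h]
    simp only [map_add, map_mul]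
    ring
  total q := by
    obtain ⟨n, c, rfl | rfl⟩ := exists_eq_div q
    · exact .inl ⟨n, c, rfl⟩
    · exact .inr ⟨n, c, by simp⟩
  eq_zero := by
    rintro _ ⟨a, b, rfl⟩ ⟨c, d, h⟩
    have hb := of_succ_ne_zero b
    have hd := of_succ_ne_zero d
    rw [← neg_div, div_eq_div_iff hb hd] at h
    -- Cross-multiplication moves the equation to the natural numbers, where a sum vanishes only if
    -- both summands do.
    have h2 : a * (d + 1) + c * (b + 1) = 0 := of_injective (by
      simp only [map_add, map_mul, map_one, map_zero]
      linear_combination -h)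
    have h3 := mul_eq_zero.1 (NN.add_eq_zero' h2)
    rw [h3.resolve_right (NN.add_one_ne_zero d)]
    simp

noncomputable instance : LinearOrder (QQ M) := isNonnegCone.linearOrder

instance : IsStrictOrderedRing (QQ M) := isNonnegCone.isStrictOrderedRing

theorem le_iff {p q : QQ M} : p ≤ q ↔ ∃ n c, q - p = of n / (of c + 1) := Iff.rfl

theorem of_nonneg (n : NN M) : 0 ≤ of n := le_iff.2 ⟨n, 0, by simp⟩

theorem of_le_of {m n : NN M} : of m ≤ of n ↔ m ≤ n := by
  have h {m n : NN M} (h : m ≤ n) : of m ≤ of n := by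
    obtain ⟨k, rfl⟩ := h
    rw [map_add]
    exact le_add_of_nonneg_right (of_nonneg k)
  refine ⟨fun h' => ?_, h⟩
  rcases le_total m n with h1 | h1
  · exact h1
  · exact (of_injective ((h h1).antisymm h')).ge

theorem exists_le_of (q : QQ M) : ∃ n, q ≤ of n := by
  obtain ⟨n, c, rfl | rfl⟩ := exists_eq_div q
  · exact ⟨n, div_le_self (of_nonneg n) (by linarith [of_nonneg c])⟩
  · refine ⟨0, ?_⟩
    rw [map_zero, neg_nonpos]
    have := of_nonneg n
    have := of_nonneg c
    positivity

theorem exists_inv_lt {q : QQ M} (hq : 0 < q) : ∃ n, (of n + 1)⁻¹ < q := by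
  obtain ⟨n, hn⟩ := exists_le_of q⁻¹
  exact ⟨n, inv_lt_of_inv_lt₀ hq (by linarith)⟩

/-- The fraction `(a - b) / (c + 1)`. -/
noncomputable def frac (p : NN M × NN M × NN M) : QQ M := (of p.1 - of p.2.1) / (of p.2.2 + 1)

theorem frac_surjective : Function.Surjective (frac (M := M)) := fun q => by
  obtain ⟨n, c, rfl | rfl⟩ := exists_eq_div q
  · exact ⟨(n, 0, c), by simp [frac]⟩
  · exact ⟨(0, n, c), by simp [frac, neg_div]⟩

/-- Denominators are cleared and negative terms moved across, leaving a comparison in `NN M`, where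
the order is already known to be inner. -/
theorem frac_le_frac (p q : NN M × NN M × NN M) : frac p ≤ frac q ↔
    p.1 * (q.2.2 + 1) + q.2.1 * (p.2.2 + 1) ≤ q.1 * (p.2.2 + 1) + p.2.1 * (q.2.2 + 1) := by
  have h1 := of_nonneg p.2.2
  have h2 := of_nonneg q.2.2
  rw [frac, frac, div_le_div_iff₀ (by linarith) (by linarith), ← of_le_of]
  simp only [map_add, map_mul, map_one]
  constructor <;> intro h <;> linarith

@[fun_prop]
theorem inn_frac_le {f g : α → NN M × NN M × NN M} (hf : Inn M f) (hg : Inn M g) :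
    Inn M fun a => frac (f a) ≤ frac (g a) := by
  simp only [frac_le_frac]
  fun_prop

theorem inn_frac_eq :
    Inn M fun p : (NN M × NN M × NN M) × (NN M × NN M × NN M) => frac p.1 = frac p.2 := by
  simp only [le_antisymm_iff]
  fun_prop

/-- The field structure comes from the ordinary fraction field; this code by classes of triples of
natural numbers turns it into a set of `M`. -/
noncomputable instance instCode : Code M (QQ M) := .ofSurj frac frac_surjective inn_frac_eq

theorem inn_frac : Inn M (frac (M := M)) := Inn.proj frac frac_surjective inn_frac_eq

attribute [irreducible] instCode

@[fun_prop]
theorem inn_of {f : α → NN M} (hf : Inn M f) : Inn M fun a => of (f a) :=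
  .congr_fun (g := fun a => frac (f a, 0, 0)) (fun a => by simp [frac])
    (inn_frac.comp (by fun_prop))

@[fun_prop]
theorem inn_le {f g : α → QQ M} (hf : Inn M f) (hg : Inn M g) : Inn M fun a => f a ≤ g a :=
  (Inn.of_comp_surj₂ inn_frac frac_surjective (f := fun x y => x ≤ y)
    (g := fun p q => frac p ≤ frac q) (by fun_prop) fun _ _ => rfl).comp (hf.prodMk hg)

@[fun_prop]
theorem inn_lt {f g : α → QQ M} (hf : Inn M f) (hg : Inn M g) : Inn M fun a => f a < g a := by
  simp only [← not_le]
  fun_prop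

@[fun_prop]
theorem inn_add {f g : α → QQ M} (hf : Inn M f) (hg : Inn M g) : Inn M fun a => f a + g a :=
  (Inn.of_comp_surj₂ inn_frac frac_surjective (f := fun x y => x + y)
    (g := fun p q => frac (p.1 * (q.2.2 + 1) + q.1 * (p.2.2 + 1),
      p.2.1 * (q.2.2 + 1) + q.2.1 * (p.2.2 + 1), p.2.2 * q.2.2 + p.2.2 + q.2.2))
    (inn_frac.comp (by fun_prop)) fun p q => by
      have h1 := of_succ_ne_zero p.2.2
      have h2 := of_succ_ne_zero q.2.2
      have h3 := of_succ_ne_zero (p.2.2 * q.2.2 + p.2.2 + q.2.2)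
      rw [frac, frac, frac, div_add_div _ _ h1 h2, div_eq_div_iff (mul_ne_zero h1 h2) h3]
      simp only [map_add, map_mul, map_one]
      ring).comp (hf.prodMk hg)

@[fun_prop]
theorem inn_mul {f g : α → QQ M} (hf : Inn M f) (hg : Inn M g) : Inn M fun a => f a * g a :=
  (Inn.of_comp_surj₂ inn_frac frac_surjective (f := fun x y => x * y)
    (g := fun p q => frac (p.1 * q.1 + p.2.1 * q.2.1,
      p.1 * q.2.1 + p.2.1 * q.1, p.2.2 * q.2.2 + p.2.2 + q.2.2))
    (inn_frac.comp (by fun_prop)) fun p q => by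
      have h1 := of_succ_ne_zero p.2.2
      have h2 := of_succ_ne_zero q.2.2
      have h3 := of_succ_ne_zero (p.2.2 * q.2.2 + p.2.2 + q.2.2)
      rw [frac, frac, frac, div_mul_div_comm, div_eq_div_iff (mul_ne_zero h1 h2) h3]
      simp only [map_add, map_mul]
      ring).comp (hf.prodMk hg)

@[fun_prop]
theorem inn_neg {f : α → QQ M} (hf : Inn M f) : Inn M fun a => -f a :=
  .congr_fun (g := fun a => (-1) * f a) (fun a => by ring) (by fun_prop)

@[fun_prop]
theorem inn_sub {f g : α → QQ M} (hf : Inn M f) (hg : Inn M g) : Inn M fun a => f a - g a := by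
  simp only [sub_eq_add_neg]
  fun_prop

@[fun_prop]
theorem inn_inv {f : α → QQ M} (hf : Inn M f) : Inn M fun a => (f a)⁻¹ := by
  have : Inn M fun x : QQ M => x⁻¹ := by
    -- The first alternative is the convention `0⁻¹ = 0`.
    refine .of_pred (R := fun x y => (x = 0 ∧ y = 0) ∨ x * y = 1) (by fun_prop) fun x y => ?_
    by_cases hx : x = 0
    · simp [hx, eq_comm]
    · simp only [hx, false_and, false_or]
      exact ⟨inv_eq_of_mul_eq_one_right, fun h => h ▸ mul_inv_cancel₀ hx⟩
  exact this.comp hf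

@[fun_prop]
theorem inn_abs {f : α → QQ M} (hf : Inn M f) : Inn M fun a => |f a| := by
  have : Inn M fun x : QQ M => |x| := by
    refine .of_pred (R := fun x y => (0 ≤ x ∧ y = x) ∨ (x < 0 ∧ y = -x)) (by fun_prop) fun x y => ?_
    rcases le_or_gt 0 x with hx | hx
    · simp [hx, abs_of_nonneg hx, hx.not_gt, eq_comm]
    · simp [hx, abs_of_neg hx, hx.not_ge, eq_comm]
  exact this.comp hf

end QQ

end ZFModel

namespace ZFModel

open Code (dom code)

variable {M : Type u} [setLang.Structure M] [ZF M]
variable {α β γ δ : Type*} [Code M α] [Code M β] [Code M γ] [Code M δ]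

/-! ### Cauchy sequences of rational numbers -/

/-- `x` is a Cauchy sequence. -/
def IsCau (x : NN M → QQ M) : Prop :=
  ∀ ε, 0 < ε → ∃ N, ∀ n, N ≤ n → |x n - x N| < ε

/-- `x` converges to zero. -/
def IsNull (x : NN M → QQ M) : Prop :=
  ∀ ε, 0 < ε → ∃ N, ∀ n, N ≤ n → |x n| < ε

/-- `x` is eventually bounded below by a positive number. -/
def IsPos (x : NN M → QQ M) : Prop :=
  ∃ ε, 0 < ε ∧ ∃ N, ∀ n, N ≤ n → ε ≤ x n

namespace IsCau

variable {x y : NN M → QQ M}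

theorem exists_forall (hx : IsCau x) {ε : QQ M} (hε : 0 < ε) :
    ∃ N, ∀ m n, N ≤ m → N ≤ n → |x m - x n| < ε := by
  obtain ⟨N, hN⟩ := hx (ε / 2) (by linarith)
  refine ⟨N, fun m n hm hn => ?_⟩
  have h1 := abs_lt.1 (hN m hm)
  have h2 := abs_lt.1 (hN n hn)
  rw [abs_lt]
  constructor <;> linarith

theorem const (q : QQ M) : IsCau fun _ => q := fun ε hε => ⟨0, fun n _ => by simpa⟩

theorem add (hx : IsCau x) (hy : IsCau y) : IsCau fun n => x n + y n := fun ε hε => by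
  obtain ⟨N, hN⟩ := hx.exists_forall (half_pos hε)
  obtain ⟨K, hK⟩ := hy.exists_forall (half_pos hε)
  refine ⟨max N K, fun n hn => ?_⟩
  have h1 := abs_lt.1 (hN n _ (le_trans (le_max_left N K) hn) (le_max_left N K))
  have h2 := abs_lt.1 (hK n _ (le_trans (le_max_right N K) hn) (le_max_right N K))
  rw [abs_lt]
  constructor <;> linarith

theorem neg (hx : IsCau x) : IsCau fun n => -x n := fun ε hε => by
  obtain ⟨N, hN⟩ := hx ε hε
  refine ⟨N, fun n hn => ?_⟩
  rw [← neg_sub', abs_neg]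
  exact hN n hn

theorem exists_bound (hx : IsCau x) : ∃ B, 0 < B ∧ ∃ N, ∀ n, N ≤ n → |x n| ≤ B := by
  obtain ⟨N, hN⟩ := hx 1 one_pos
  refine ⟨|x N| + 1, by positivity, N, fun n hn => ?_⟩
  have := abs_sub_abs_le_abs_sub (x n) (x N)
  linarith [hN n hn]

theorem mul (hx : IsCau x) (hy : IsCau y) : IsCau fun n => x n * y n := fun ε hε => by
  obtain ⟨B, hB, N₁, hN₁⟩ := hx.exists_bound
  obtain ⟨C, hC, N₂, hN₂⟩ := hy.exists_bound
  obtain ⟨N₃, hN₃⟩ := hx.exists_forall (show 0 < ε / (2 * C) by positivity)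
  obtain ⟨N₄, hN₄⟩ := hy.exists_forall (show 0 < ε / (2 * B) by positivity)
  refine ⟨max (max N₁ N₂) (max N₃ N₄), fun n hn => ?_⟩
  set N := max (max N₁ N₂) (max N₃ N₄)
  have h1 : N₁ ≤ N := le_trans (le_max_left _ _) (le_max_left _ _)
  have h2 : N₂ ≤ N := le_trans (le_max_right _ _) (le_max_left _ _)
  have h3 : N₃ ≤ N := le_trans (le_max_left _ _) (le_max_right _ _)
  have h4 : N₄ ≤ N := le_trans (le_max_right _ _) (le_max_right _ _)
  have e1 := hN₁ N h1
  have e2 := hN₂ n (h2.trans hn)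
  have e3 := hN₃ n N (h3.trans hn) h3
  have e4 := hN₄ n N (h4.trans hn) h4
  calc |x n * y n - x N * y N| = |(x n - x N) * y n + x N * (y n - y N)| := by ring_nf
    _ ≤ |(x n - x N) * y n| + |x N * (y n - y N)| := abs_add_le _ _
    _ = |x n - x N| * |y n| + |x N| * |y n - y N| := by rw [abs_mul, abs_mul]
    _ ≤ |x n - x N| * C + B * |y n - y N| := by gcongr
    _ < ε / (2 * C) * C + B * (ε / (2 * B)) := by gcongr
    _ = ε := by field_simp; norm_num

/-- A Cauchy sequence that is not null has `|x n| ≥ ε` for arbitrarily late `n`. Once its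
oscillation is below `ε / 2`, one such term fixes the sign and the bound `ε / 2` from there on. -/
theorem trichotomy (hx : IsCau x) : IsNull x ∨ IsPos x ∨ IsPos fun n => -x n := by
  refine or_iff_not_imp_left.2 fun h => ?_
  unfold IsNull at h
  push Not at h
  obtain ⟨ε, hε, h⟩ := h
  obtain ⟨N, hN⟩ := hx.exists_forall (half_pos hε)
  obtain ⟨n, hn, hn'⟩ := h N
  refine (le_abs.1 hn').imp (fun h => ?_) fun h => ?_ <;>
  · refine ⟨ε / 2, half_pos hε, N, fun m hm => ?_⟩
    have := abs_lt.1 (hN n m hn hm)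
    linarith

theorem inv (hx : IsCau x) (h : ¬ IsNull x) : IsCau fun n => (x n)⁻¹ := by
  have : ∃ δ, 0 < δ ∧ ∃ N, ∀ n, N ≤ n → δ ≤ |x n| := by
    rcases hx.trichotomy.resolve_left h with ⟨δ, hδ, N, hN⟩ | ⟨δ, hδ, N, hN⟩
    · exact ⟨δ, hδ, N, fun n hn => (hN n hn).trans (le_abs_self _)⟩
    · exact ⟨δ, hδ, N, fun n hn => (hN n hn).trans (neg_le_abs _)⟩
  obtain ⟨δ, hδ, N₁, hN₁⟩ := this
  intro ε hε
  -- The difference of two inverses is the difference of the terms divided by their product, whose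
  -- absolute value is at least `δ * δ`.
  obtain ⟨N₂, hN₂⟩ := hx.exists_forall (show 0 < ε * (δ * δ) by positivity)
  refine ⟨max N₁ N₂, fun n hn => ?_⟩
  have e1 := hN₁ n ((le_max_left _ _).trans hn)
  have e2 := hN₁ _ (le_max_left N₁ N₂)
  have e3 := hN₂ _ n (le_max_right N₁ N₂) ((le_max_right _ _).trans hn)
  set N := max N₁ N₂
  have p1 : 0 < |x n| := hδ.trans_le e1
  have p2 : 0 < |x N| := hδ.trans_le e2
  rw [inv_sub_inv (abs_pos.1 p1) (abs_pos.1 p2), abs_div, abs_mul, div_lt_iff₀ (by positivity)]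
  exact e3.trans_le (by gcongr)

end IsCau

theorem IsPos.not_neg {x : NN M → QQ M} (h : IsPos x) : ¬ IsPos fun n => -x n := by
  rintro ⟨ε, hε, N, hN⟩
  obtain ⟨δ, hδ, K, hK⟩ := h
  have h1 := hN _ (le_max_left N K)
  have h2 := hK _ (le_max_right N K)
  linarith

theorem IsPos.not_null {x : NN M → QQ M} (h : IsPos x) : ¬ IsNull x := fun h' => by
  obtain ⟨δ, hδ, K, hK⟩ := h
  obtain ⟨N, hN⟩ := h' δ hδ
  have h1 := abs_lt.1 (hN _ (le_max_left N K))
  have h2 := hK _ (le_max_right N K)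
  linarith

theorem IsPos.add_null {x y : NN M → QQ M} (h : IsPos x) (hy : IsNull y) :
    IsPos fun n => x n + y n := by
  obtain ⟨δ, hδ, K, hK⟩ := h
  obtain ⟨N, hN⟩ := hy (δ / 2) (half_pos hδ)
  refine ⟨δ / 2, half_pos hδ, max N K, fun n hn => ?_⟩
  have h1 := abs_lt.1 (hN n ((le_max_left N K).trans hn))
  have h2 := hK n ((le_max_right N K).trans hn)
  linarith

theorem IsPos.add {x y : NN M → QQ M} (hx : IsPos x) (hy : IsPos y) :
    IsPos fun n => x n + y n := by
  obtain ⟨δ, hδ, K, hK⟩ := hx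
  obtain ⟨ε, hε, N, hN⟩ := hy
  exact ⟨δ + ε, by linarith, max N K, fun n hn =>
    add_le_add (hK n ((le_max_right N K).trans hn)) (hN n ((le_max_left N K).trans hn))⟩

theorem IsPos.mul {x y : NN M → QQ M} (hx : IsPos x) (hy : IsPos y) :
    IsPos fun n => x n * y n := by
  obtain ⟨δ, hδ, K, hK⟩ := hx
  obtain ⟨ε, hε, N, hN⟩ := hy
  exact ⟨δ * ε, by positivity, max N K, fun n hn =>
    mul_le_mul (hK n ((le_max_right N K).trans hn)) (hN n ((le_max_left N K).trans hn)) hε.le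
      (hδ.le.trans (hK n ((le_max_right N K).trans hn)))⟩

variable (M) in
/-- The ring of Cauchy sequences of rational numbers of `M`. -/
noncomputable def cauSubring : Subring (NN M → QQ M) where
  carrier := {x | Inn M x ∧ IsCau x}
  mul_mem' hx hy := ⟨QQ.inn_mul hx.1 hy.1, hx.2.mul hy.2⟩
  add_mem' hx hy := ⟨QQ.inn_add hx.1 hy.1, hx.2.add hy.2⟩
  one_mem' := ⟨.const 1, .const 1⟩
  zero_mem' := ⟨.const 0, .const 0⟩
  neg_mem' hx := ⟨QQ.inn_neg hx.1, hx.2.neg⟩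

variable (M) in
/-- The ideal of null sequences. -/
noncomputable def nullIdeal : Ideal (cauSubring M) where
  carrier := {x | IsNull x.1}
  zero_mem' ε hε := ⟨0, fun n _ => by simpa⟩
  add_mem' {x y} hx hy ε hε := by
    obtain ⟨N, hN⟩ := hx (ε / 2) (half_pos hε)
    obtain ⟨K, hK⟩ := hy (ε / 2) (half_pos hε)
    refine ⟨max N K, fun n hn => ?_⟩
    have h1 := hN n ((le_max_left N K).trans hn)
    have h2 := hK n ((le_max_right N K).trans hn)
    exact (abs_add_le _ _).trans_lt (by linarith)
  smul_mem' c x hx ε hε := by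
    obtain ⟨B, hB, N, hN⟩ := c.2.2.exists_bound
    obtain ⟨K, hK⟩ := hx (ε / B) (by positivity)
    refine ⟨max N K, fun n hn => ?_⟩
    have h1 := hN n ((le_max_left N K).trans hn)
    have h2 := hK n ((le_max_right N K).trans hn)
    change |c.1 n * x.1 n| < ε
    rw [abs_mul]
    calc |c.1 n| * |x.1 n| ≤ B * |x.1 n| := by gcongr
      _ < B * (ε / B) := by gcongr
      _ = ε := by field_simp

/-! ### Real numbers -/

theorem isField_quotient_nullIdeal : IsField (cauSubring M ⧸ nullIdeal M) where
  exists_pair_ne := ⟨1, 0, fun h => by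
    rw [← map_one (Ideal.Quotient.mk _), Ideal.Quotient.eq_zero_iff_mem] at h
    obtain ⟨N, hN⟩ := h 1 one_pos
    simpa using hN N le_rfl⟩
  mul_comm := mul_comm
  mul_inv_cancel {r} hr := by
    obtain ⟨⟨x, hx, hxc⟩, rfl⟩ := Ideal.Quotient.mk_surjective r
    rw [Ne, Ideal.Quotient.eq_zero_iff_mem] at hr
    have : ∃ N, ∀ n, N ≤ n → x n ≠ 0 := by
      rcases hxc.trichotomy.resolve_left hr with ⟨δ, hδ, N, hN⟩ | ⟨δ, hδ, N, hN⟩ <;>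
      · refine ⟨N, fun n hn h0 => ?_⟩
        have := hN n hn
        simp only [h0, neg_zero] at this
        linarith
    obtain ⟨N, hN⟩ := this
    -- Terms before `N` may be zero and then contribute `0⁻¹ = 0`; from `N` on the product is
    -- exactly `1`.
    refine ⟨Ideal.Quotient.mk _ ⟨fun n => (x n)⁻¹, by fun_prop, hxc.inv hr⟩, ?_⟩
    rw [← map_mul, ← map_one (Ideal.Quotient.mk _), Ideal.Quotient.eq]
    intro ε hε
    refine ⟨N, fun n hn => ?_⟩
    change |x n * (x n)⁻¹ - 1| < ε
    simpa [mul_inv_cancel₀ (hN n hn)]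

variable (M) in
/-- The real numbers of `M`. -/
def RR : Type u := cauSubring M ⧸ nullIdeal M

namespace RR

noncomputable instance instField : Field (RR M) :=
  (isField_quotient_nullIdeal.toField : Field (cauSubring M ⧸ nullIdeal M))

/-- The limit of a Cauchy sequence. -/
noncomputable def mk (x : NN M → QQ M) (hx : Inn M x) (hc : IsCau x) : RR M :=
  Ideal.Quotient.mk (nullIdeal M) ⟨x, hx, hc⟩

variable {x y : NN M → QQ M} {hx : Inn M x} {hy : Inn M y} {hxc : IsCau x} {hyc : IsCau y}

theorem mk_eq_mk : mk x hx hxc = mk y hy hyc ↔ IsNull fun n => x n - y n :=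
  Ideal.Quotient.eq

theorem ind {P : RR M → Prop} (h : ∀ x hx hxc, P (mk x hx hxc)) (r : RR M) : P r := by
  obtain ⟨⟨x, hx, hxc⟩, rfl⟩ := Ideal.Quotient.mk_surjective r
  exact h x hx hxc

theorem mk_add : mk x hx hxc + mk y hy hyc =
    mk (fun n => x n + y n) (by fun_prop) (hxc.add hyc) := rfl

theorem mk_mul : mk x hx hxc * mk y hy hyc =
    mk (fun n => x n * y n) (by fun_prop) (hxc.mul hyc) := rfl

theorem neg_mk : -mk x hx hxc = mk (fun n => -x n) (by fun_prop) hxc.neg := rfl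

theorem zero_def : (0 : RR M) = mk (fun _ => 0) (.const 0) (.const 0) := rfl

theorem one_def : (1 : RR M) = mk (fun _ => 1) (.const 1) (.const 1) := rfl

attribute [irreducible] mk instField

theorem mk_eq_zero : mk x hx hxc = 0 ↔ IsNull x := by
  rw [zero_def, mk_eq_mk]
  simp

/-- Positivity. -/
def Pos (r : RR M) : Prop := ∃ x hx hxc, r = mk x hx hxc ∧ IsPos x

theorem pos_mk : Pos (mk x hx hxc) ↔ IsPos x := by
  refine ⟨?_, fun h => ⟨x, hx, hxc, rfl, h⟩⟩
  rintro ⟨y, hy, hyc, h, h'⟩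
  simpa using h'.add_null (mk_eq_mk.1 h)

theorem isNonnegCone : IsNonnegCone fun r : RR M => r = 0 ∨ Pos r where
  add := by
    rintro r s (rfl | hr) (rfl | hs)
    · simp
    · simp [hs]
    · simp [hr]
    · obtain ⟨x, hx, hxc, rfl, h⟩ := hr
      obtain ⟨y, hy, hyc, rfl, h'⟩ := hs
      exact .inr ⟨_, _, _, mk_add, h.add h'⟩
  mul := by
    rintro r s (rfl | hr) (rfl | hs)
    · simp
    · simp
    · simp
    · obtain ⟨x, hx, hxc, rfl, h⟩ := hr
      obtain ⟨y, hy, hyc, rfl, h'⟩ := hs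
      exact .inr ⟨_, _, _, mk_mul, h.mul h'⟩
  total r := by
    induction r using ind with
    | h x hx hxc =>
      rcases hxc.trichotomy with h | h | h
      · exact .inl (.inl (mk_eq_zero.2 h))
      · exact .inl (.inr ⟨_, _, _, rfl, h⟩)
      · exact .inr (.inr ⟨_, _, _, neg_mk, h⟩)
  eq_zero := by
    rintro r (rfl | hr) (h | h)
    · rfl
    · rfl
    · exact neg_eq_zero.1 h
    · obtain ⟨x, hx, hxc, rfl, h'⟩ := hr
      rw [neg_mk, pos_mk] at h
      exact (h'.not_neg h).elim

noncomputable instance : LinearOrder (RR M) := isNonnegCone.linearOrder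

instance : IsStrictOrderedRing (RR M) := isNonnegCone.isStrictOrderedRing

theorem le_iff' {r s : RR M} : r ≤ s ↔ s - r = 0 ∨ Pos (s - r) := Iff.rfl

theorem mk_sub : mk x hx hxc - mk y hy hyc =
    mk (fun n => x n + -y n) (by fun_prop) (hxc.add hyc.neg) := by
  rw [sub_eq_add_neg, neg_mk, mk_add]

theorem mk_lt_mk : mk x hx hxc < mk y hy hyc ↔ IsPos fun n => y n + -x n := by
  rw [← pos_mk (hx := by fun_prop) (hxc := hyc.add hxc.neg),
    ← mk_sub (hx := hy) (hy := hx) (hxc := hyc) (hyc := hxc), lt_iff_le_and_ne, le_iff']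
  constructor
  · rintro ⟨h | h, h'⟩
    · exact (h' (sub_eq_zero.1 h).symm).elim
    · exact h
  · refine fun h => ⟨.inr h, fun e => ?_⟩
    rw [e, sub_self, zero_def, pos_mk] at h
    exact h.not_null fun ε hε => ⟨0, fun _ _ => by simpa⟩

theorem mk_le_mk : mk x hx hxc ≤ mk y hy hyc ↔ ¬ IsPos fun n => x n + -y n := by
  rw [← not_lt, mk_lt_mk]

end RR

end ZFModel

/-! ### The real numbers as a coded type. -/

namespace ZFModel

open Code (dom code)

variable {M : Type u} [setLang.Structure M] [ZF M]
variable {α β γ δ : Type*} [Code M α] [Code M β] [Code M γ] [Code M δ]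

variable (M) in
/-- The set of Cauchy sequences of rational numbers of `M`. -/
structure CauSequence where
  /-- The sequence. -/
  seq : IFun M (NN M) (QQ M)
  cau : IsCau seq.app

namespace CauSequence

theorem seq_injective : Function.Injective (seq (M := M)) := fun x y h => by
  cases x
  cases y
  congr

theorem inn_range : Inn M fun x : IFun M (NN M) (QQ M) => ∃ c : CauSequence M, c.seq = x := by
  refine Inn.congr_pred (Q := fun x => IsCau x.app)
    (fun x => ⟨fun ⟨c, h⟩ => h ▸ c.cau, fun h => ⟨⟨x, h⟩, rfl⟩⟩) ?_
  unfold IsCau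
  simp only [forall_iff_not_exists, imp_iff_not_or]
  fun_prop

noncomputable instance : Code M (CauSequence M) := .ofInj seq seq_injective inn_range

@[fun_prop]
theorem inn_seq {f : α → CauSequence M} (hf : Inn M f) : Inn M fun a => (f a).seq := hf

theorem inn_of_seq {f : α → CauSequence M} (hf : Inn M fun a => (f a).seq) : Inn M f := hf

end CauSequence

namespace RR

/-- The limit of a Cauchy sequence. -/
noncomputable def lim (x : CauSequence M) : RR M := mk x.seq.app (.of_iFun x.seq) x.cau

theorem lim_surjective : Function.Surjective (lim (M := M)) := fun r => by
  induction r using ind with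
  | h x hx hxc => exact ⟨⟨⟨x, hx⟩, hxc⟩, rfl⟩

theorem inn_lim_eq : Inn M fun p : CauSequence M × CauSequence M => lim p.1 = lim p.2 := by
  unfold lim
  simp only [mk_eq_mk]
  unfold IsNull
  simp only [forall_iff_not_exists, imp_iff_not_or]
  fun_prop

noncomputable instance instCode : Code M (RR M) := .ofSurj lim lim_surjective inn_lim_eq

theorem inn_lim : Inn M (lim (M := M)) := Inn.proj lim lim_surjective inn_lim_eq

attribute [irreducible] instCode

@[fun_prop]
theorem inn_le {f g : α → RR M} (hf : Inn M f) (hg : Inn M g) : Inn M fun a => f a ≤ g a :=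
  (Inn.of_comp_surj₂ inn_lim lim_surjective (f := fun x y => x ≤ y)
    (g := fun x y => lim x ≤ lim y) (by
      unfold lim
      simp only [mk_le_mk]
      unfold IsPos
      simp only [forall_iff_not_exists, imp_iff_not_or]
      fun_prop) fun _ _ => rfl).comp (hf.prodMk hg)

@[fun_prop]
theorem inn_lt {f g : α → RR M} (hf : Inn M f) (hg : Inn M g) : Inn M fun a => f a < g a := by
  simp only [← not_le]
  fun_prop

@[fun_prop]
theorem inn_add {f g : α → RR M} (hf : Inn M f) (hg : Inn M g) : Inn M fun a => f a + g a :=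
  (Inn.of_comp_surj₂ inn_lim lim_surjective (f := fun x y => x + y)
    (g := fun x y => lim ⟨⟨fun n => x.seq.app n + y.seq.app n, by fun_prop⟩, x.cau.add y.cau⟩)
    (inn_lim.comp (CauSequence.inn_of_seq (by fun_prop))) fun _ _ => mk_add).comp (hf.prodMk hg)

@[fun_prop]
theorem inn_mul {f g : α → RR M} (hf : Inn M f) (hg : Inn M g) : Inn M fun a => f a * g a :=
  (Inn.of_comp_surj₂ inn_lim lim_surjective (f := fun x y => x * y)
    (g := fun x y => lim ⟨⟨fun n => x.seq.app n * y.seq.app n, by fun_prop⟩, x.cau.mul y.cau⟩)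
    (inn_lim.comp (CauSequence.inn_of_seq (by fun_prop))) fun _ _ => mk_mul).comp (hf.prodMk hg)

@[fun_prop]
theorem inn_neg {f : α → RR M} (hf : Inn M f) : Inn M fun a => -f a :=
  .congr_fun (g := fun a => (-1) * f a) (fun a => by ring) (by fun_prop)

@[fun_prop]
theorem inn_sub {f g : α → RR M} (hf : Inn M f) (hg : Inn M g) : Inn M fun a => f a - g a := by
  simp only [sub_eq_add_neg]
  fun_prop

@[fun_prop]
theorem inn_abs {f : α → RR M} (hf : Inn M f) : Inn M fun a => |f a| := by
  have : Inn M fun x : RR M => |x| := by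
    refine .of_pred (R := fun x y => (0 ≤ x ∧ y = x) ∨ (x < 0 ∧ y = -x)) (by fun_prop) fun x y => ?_
    rcases le_or_gt 0 x with hx | hx
    · simp [hx, abs_of_nonneg hx, hx.not_gt, eq_comm]
    · simp [hx, abs_of_neg hx, hx.not_ge, eq_comm]
  exact this.comp hf

/-- The inclusion of the rational numbers. -/
noncomputable def of : QQ M →+* RR M where
  toFun q := mk (fun _ => q) (.const q) (.const q)
  map_zero' := zero_def.symm
  map_one' := one_def.symm
  map_add' _ _ := mk_add.symm
  map_mul' _ _ := mk_mul.symm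

theorem of_def (q : QQ M) : of q = mk (fun _ => q) (.const q) (.const q) := rfl

@[fun_prop]
theorem inn_of {f : α → QQ M} (hf : Inn M f) : Inn M fun a => of (f a) :=
  .congr_fun (g := fun a => lim ⟨⟨fun _ => f a, .const _⟩, .const _⟩) (fun _ => rfl)
    (inn_lim.comp (CauSequence.inn_of_seq (by fun_prop)))

attribute [irreducible] of

theorem of_le_of {p q : QQ M} : of p ≤ of q ↔ p ≤ q := by
  rw [of_def, of_def, mk_le_mk, ← not_lt, not_iff_not]
  constructor
  · rintro ⟨ε, hε, N, h⟩
    linarith [h N le_rfl]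
  · exact fun h => ⟨p + -q, by linarith, 0, fun _ _ => le_rfl⟩

theorem of_lt_of {p q : QQ M} : of p < of q ↔ p < q := lt_iff_lt_of_le_iff_le of_le_of

theorem mk_le_of {x : NN M → QQ M} {hx : Inn M x} {hxc : IsCau x} {q : QQ M} (N : NN M)
    (h : ∀ n, N ≤ n → x n ≤ q) : mk x hx hxc ≤ of q := by
  rw [of_def, mk_le_mk]
  rintro ⟨ε, hε, K, hK⟩
  linarith [h _ (le_max_left N K), hK _ (le_max_right N K)]

theorem of_le_mk {x : NN M → QQ M} {hx : Inn M x} {hxc : IsCau x} {q : QQ M} (N : NN M)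
    (h : ∀ n, N ≤ n → q ≤ x n) : of q ≤ mk x hx hxc := by
  rw [of_def, mk_le_mk]
  rintro ⟨ε, hε, K, hK⟩
  linarith [h _ (le_max_left N K), hK _ (le_max_right N K)]

/-- The number `1 / (n + 1)`. -/
noncomputable def tiny (n : NN M) : RR M := of (QQ.of n + 1)⁻¹

theorem exists_tiny_lt {r : RR M} (hr : 0 < r) : ∃ n, tiny n < r := by
  induction r using ind with
  | h x hx hxc =>
    rw [zero_def, mk_lt_mk] at hr
    obtain ⟨ε, hε, N, hN⟩ := hr
    obtain ⟨n, hn⟩ := QQ.exists_inv_lt hε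
    exact ⟨n, (of_lt_of.2 hn).trans_le (of_le_mk N fun n hn => by simpa using hN n hn)⟩

theorem le_of_forall_tiny {r s : RR M} (h : ∀ n, r ≤ s + tiny n) : r ≤ s := by
  by_contra! hlt
  obtain ⟨n, hn⟩ := exists_tiny_lt (sub_pos.2 hlt)
  linarith [h n]

theorem exists_of_le (r : RR M) : ∃ q, of q ≤ r := by
  induction r using ind with
  | h x hx hxc =>
    obtain ⟨N, hN⟩ := hxc 1 one_pos
    exact ⟨x N - 1, of_le_mk N fun n hn => by linarith [abs_lt.1 (hN n hn)]⟩

theorem exists_le_of (r : RR M) : ∃ q, r ≤ of q := by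
  induction r using ind with
  | h x hx hxc =>
    obtain ⟨N, hN⟩ := hxc 1 one_pos
    exact ⟨x N + 1, mk_le_of N fun n hn => by linarith [abs_lt.1 (hN n hn)]⟩

theorem exists_le_nat (r : RR M) : ∃ n, r ≤ of (QQ.of n) := by
  obtain ⟨q, hq⟩ := exists_le_of r
  obtain ⟨n, hn⟩ := QQ.exists_le_of q
  exact ⟨n, hq.trans (of_le_of.2 hn)⟩

end RR

end ZFModel

/-! ### Completeness of the reals, and finite sets. -/

namespace ZFModel

open Code (dom code)

variable {M : Type u} [setLang.Structure M] [ZF M]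
variable {α β γ δ : Type*} [Code M α] [Code M β] [Code M γ] [Code M δ]

namespace RR

/-- On the grid of mesh `1 / (n + 1)` starting at a rational `q₀` that is not an upper bound, take
the first upper bound `x n`. These rationals form a Cauchy sequence whose limit is the supremum;
selecting least elements avoids choice. -/
theorem exists_isLUB {B : RR M → Prop} (hB : Inn M B) (hne : ∃ b, B b)
    (hbdd : ∃ u, ∀ b, B b → b ≤ u) :
    ∃ c, (∀ b, B b → b ≤ c) ∧ ∀ u, (∀ b, B b → b ≤ u) → c ≤ u := by
  let U : QQ M → Prop := fun q => ∀ b, B b → b ≤ of q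
  have hU : Inn M U := by
    simp only [U, forall_iff_not_exists, imp_iff_not_or]
    fun_prop
  have hup {p q : QQ M} (hp : U p) (h : p ≤ q) : U q := fun b hb =>
    (hp b hb).trans (of_le_of.2 h)
  obtain ⟨q₀, hq₀⟩ : ∃ q, ¬ U q := by
    obtain ⟨b, hb⟩ := hne
    obtain ⟨q, hq⟩ := exists_of_le (b - 1)
    exact ⟨q, fun h => by linarith [h b hb]⟩
  have hex (n : NN M) : ∃ k, U (q₀ + QQ.of k * (QQ.of n + 1)⁻¹) ∧
      ∀ m, U (q₀ + QQ.of m * (QQ.of n + 1)⁻¹) → k ≤ m := by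
    refine NN.exists_least (P := fun k => U (q₀ + QQ.of k * (QQ.of n + 1)⁻¹)) (by fun_prop) ?_
    obtain ⟨u, hu⟩ := hbdd
    obtain ⟨q, hq⟩ := exists_le_of u
    obtain ⟨K, hK⟩ := QQ.exists_le_of (q - q₀)
    -- This grid point is `q₀ + K`, which exceeds the upper bound `q`.
    refine ⟨K * (n + 1), fun b hb => (hu b hb).trans (hq.trans (of_le_of.2 ?_))⟩
    rw [map_mul, map_add, map_one, mul_inv_cancel_right₀ (QQ.of_succ_ne_zero n)]
    linarith
  choose k hk hk' using hex
  have hkinn : Inn M k := by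
    refine .of_pred (R := fun n j => U (q₀ + QQ.of j * (QQ.of n + 1)⁻¹) ∧
      ∀ m, U (q₀ + QQ.of m * (QQ.of n + 1)⁻¹) → j ≤ m) ?_ fun n j => ?_
    · simp only [forall_iff_not_exists, imp_iff_not_or]
      fun_prop
    · constructor
      · exact fun h => (hk' n j h.1).antisymm (h.2 _ (hk n))
      · rintro rfl
        exact ⟨hk n, hk' n⟩
  let x : NN M → QQ M := fun n => q₀ + QQ.of (k n) * (QQ.of n + 1)⁻¹
  have hxU (n : NN M) : U (x n) := hk n
  -- The preceding grid point is not an upper bound, by minimality of `k n`. There is one, since `k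
  -- n = 0` would make `q₀` an upper bound.
  have hxU' (n : NN M) : ¬ U (x n - (QQ.of n + 1)⁻¹) := fun h => by
    rcases NN.eq_zero_or_succ (k n) with h0 | ⟨j, hj⟩
    · exact hq₀ (by simpa [h0] using hk n)
    · have hle := hk' n j (by
        have e : x n - (QQ.of n + 1)⁻¹ = q₀ + QQ.of j * (QQ.of n + 1)⁻¹ := by
          simp only [x, hj, map_add, map_one]
          ring
        rwa [e] at h)
      rw [hj] at hle
      exact (NN.lt_add_one_iff.2 le_rfl).not_ge hle
  have hclose (m n : NN M) : x n - (QQ.of n + 1)⁻¹ < x m := by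
    by_contra! h
    exact hxU' n (hup (hxU m) h)
  have hinv {m n : NN M} (h : m ≤ n) : (QQ.of n + 1)⁻¹ ≤ (QQ.of m + 1)⁻¹ := by
    have := QQ.of_nonneg m
    have := QQ.of_le_of.2 h
    gcongr
  have hx : Inn M x := by fun_prop
  have hxc : IsCau x := fun ε hε => by
    obtain ⟨N, hN⟩ := QQ.exists_inv_lt hε
    refine ⟨N, fun n hn => ?_⟩
    rw [abs_lt]
    constructor <;> linarith [hclose N n, hclose n N, hinv hn]
  have h1 (n : NN M) : mk x hx hxc ≤ of (x n) + tiny n := by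
    rw [tiny, ← map_add]
    exact mk_le_of n fun m hm => by linarith [hclose n m, hinv hm]
  have h2 (n : NN M) : of (x n) - tiny n ≤ mk x hx hxc := by
    rw [tiny, ← map_sub]
    exact of_le_mk n fun m hm => (hclose m n).le
  refine ⟨mk x hx hxc, fun b hb => le_of_forall_tiny fun n => ?_, fun u hu => ?_⟩
  · linarith [hxU n b hb, h2 n]
  · by_contra! hlt
    obtain ⟨n, hn⟩ := exists_tiny_lt (show 0 < (mk x hx hxc - u) / 2 by linarith)
    have h3 := hxU' n
    simp only [U] at h3
    push Not at h3
    obtain ⟨b, hb, hb'⟩ := h3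
    rw [map_sub] at hb'
    have := hu b hb
    have := h1 n
    simp only [tiny] at *
    linarith

/-- The limit is the supremum of the eventual lower bounds of `s`, that is, its limit inferior. -/
theorem exists_limit {s : NN M → RR M} (hs : Inn M s)
    (hc : ∀ ε, 0 < ε → ∃ N, ∀ m n, N ≤ m → N ≤ n → |s m - s n| < ε) :
    ∃ c, ∀ ε, 0 < ε → ∃ N, ∀ n, N ≤ n → |s n - c| < ε := by
  have hkey {ε : RR M} {N : NN M} (h : ∀ m n, N ≤ m → N ≤ n → |s m - s n| < ε) (r : RR M)
      (hr : ∃ K, ∀ n, K ≤ n → r ≤ s n) : r ≤ s N + ε := by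
    obtain ⟨K, hK⟩ := hr
    have h1 := hK _ (le_max_right N K)
    have h2 := abs_lt.1 (h N _ le_rfl (le_max_left N K))
    linarith
  obtain ⟨c, hc1, hc2⟩ := exists_isLUB (B := fun r => ∃ N, ∀ n, N ≤ n → r ≤ s n) (by
      simp only [forall_iff_not_exists, imp_iff_not_or]
      fun_prop) (by
    obtain ⟨N, hN⟩ := hc 1 one_pos
    exact ⟨s N - 1, N, fun n hn => by linarith [abs_lt.1 (hN N n le_rfl hn)]⟩) (by
    obtain ⟨N, hN⟩ := hc 1 one_pos
    exact ⟨_, hkey hN⟩)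
  refine ⟨c, fun ε hε => ?_⟩
  obtain ⟨N, hN⟩ := hc (ε / 3) (by linarith)
  refine ⟨N, fun n hn => ?_⟩
  have h1 := hc1 (s N - ε / 3) ⟨N, fun n hn => by linarith [abs_lt.1 (hN N n le_rfl hn)]⟩
  have h2 := hc2 _ (hkey hN)
  have h3 := abs_lt.1 (hN N n le_rfl hn)
  rw [abs_lt]
  constructor <;> linarith

theorem limit_unique {s : NN M → RR M} {c d : RR M}
    (hc : ∀ ε, 0 < ε → ∃ N, ∀ n, N ≤ n → |s n - c| < ε)
    (hd : ∀ ε, 0 < ε → ∃ N, ∀ n, N ≤ n → |s n - d| < ε) : c = d := by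
  by_contra hne
  have hpos : 0 < |c - d| / 2 := half_pos (abs_pos.2 (sub_ne_zero.2 hne))
  obtain ⟨N, hN⟩ := hc _ hpos
  obtain ⟨K, hK⟩ := hd _ hpos
  have h1 := hN _ (le_max_left N K)
  have h2 := hK _ (le_max_right N K)
  have h3 := abs_sub_le c (s (max N K)) d
  rw [abs_sub_comm c (s _)] at h3
  linarith

end RR

@[fun_prop]
theorem Inn.ite {P : α → Prop} [∀ a, Decidable (P a)] {f g : α → β} (hP : Inn M P)
    (hf : Inn M f) (hg : Inn M g) : Inn M fun a => if P a then f a else g a := by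
  refine .of_pred (R := fun a b => (P a ∧ f a = b) ∨ (¬ P a ∧ g a = b)) (by fun_prop) fun a b => ?_
  by_cases h : P a <;> simp [h]

/-! ### Finite sets -/

variable (M) in
/-- The empty set. -/
noncomputable def iEmpty (α : Type*) [Code M α] : IFun M α Prop := ⟨fun _ => False, .const _⟩

/-- Insertion of an element in a set. -/
noncomputable def iInsert (a : α) (A : IFun M α Prop) : IFun M α Prop :=
  ⟨fun x => x = a ∨ A.app x, by fun_prop⟩

@[simp] theorem iEmpty_app (x : α) : (iEmpty M α).app x = False := rfl

@[simp] theorem iInsert_app (a x : α) (A : IFun M α Prop) :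
    (iInsert a A).app x = (x = a ∨ A.app x) := rfl

@[fun_prop]
theorem inn_iInsert {f : γ → α} {g : γ → IFun M α Prop} (hf : Inn M f) (hg : Inn M g) :
    Inn M fun c => iInsert (f c) (g c) := by
  unfold iInsert
  fun_prop

/-- A set of `M` is finite: it belongs to every family of `M` that contains the empty set and is
closed under insertions. -/
def IFin (A : IFun M α Prop) : Prop :=
  ∀ F : IFun M (IFun M α Prop) Prop, F.app (iEmpty M α) →
    (∀ B a, F.app B → F.app (iInsert a B)) → F.app A

@[fun_prop]
theorem inn_iFin {f : γ → IFun M α Prop} (hf : Inn M f) : Inn M fun c => IFin (f c) := by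
  simp only [IFin, forall_iff_not_exists, imp_iff_not_or]
  fun_prop

namespace IFin

theorem empty : IFin (iEmpty M α) := fun _ h _ => h

theorem insert {A : IFun M α Prop} (h : IFin A) (a : α) : IFin (iInsert a A) :=
  fun F h1 h2 => h2 _ _ (h F h1 h2)

theorem induction {A : IFun M α Prop} (hA : IFin A) {P : IFun M α Prop → Prop} (hP : Inn M P)
    (h0 : P (iEmpty M α)) (hs : ∀ B a, P B → P (iInsert a B)) : P A :=
  hA ⟨P, hP⟩ h0 hs

/-- Induction on `A` for all subsets `B` at once: a subset of `A ∪ {a}` loses `a`, becomes a subset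
of `A`, and regains `a` if needed. -/
theorem subset {A B : IFun M α Prop} (hA : IFin A) (h : ∀ x, B.app x → A.app x) : IFin B := by
  have : ∀ B : IFun M α Prop, (∀ x, B.app x → A.app x) → IFin B := by
    refine hA.induction (P := fun A => ∀ B : IFun M α Prop, (∀ x, B.app x → A.app x) → IFin B)
      ?_ (fun B hB => ?_) fun A a ih B hB => ?_
    · simp only [forall_iff_not_exists, imp_iff_not_or]
      fun_prop
    · rw [show B = iEmpty M α from IFun.ext fun x => by simpa using hB x]
      exact empty
    · have h1 := ih ⟨fun x => B.app x ∧ x ≠ a, by simp only [Ne]; fun_prop⟩ fun x hx => by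
        have := hB x hx.1
        simp only [iInsert_app] at this
        exact this.resolve_left hx.2
      by_cases ha : B.app a
      · convert h1.insert a using 1
        ext x
        simp only [iInsert_app, IFun.app_mk]
        by_cases hx : x = a <;> simp [hx, ha]
      · convert h1 using 1
        ext x
        simp only [IFun.app_mk]
        by_cases hx : x = a <;> simp [hx, ha]
  exact this B h

theorem union {A B : IFun M α Prop} (hA : IFin A) (hB : IFin B) :
    IFin (⟨fun x => A.app x ∨ B.app x, by fun_prop⟩ : IFun M α Prop) := by
  refine hA.induction
    (P := fun A => IFin (⟨fun x => A.app x ∨ B.app x, by fun_prop⟩ : IFun M α Prop))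
    (by fun_prop) ?_ fun A a ih => ?_
  · convert hB using 1
    ext x
    simp
  · convert ih.insert a using 1
    ext x
    simp [or_assoc]

theorem image {A : IFun M α Prop} (hA : IFin A) {f : α → β} (hf : Inn M f) :
    IFin (⟨fun y => ∃ x, A.app x ∧ f x = y, by fun_prop⟩ : IFun M β Prop) := by
  refine hA.induction
    (P := fun A => IFin (⟨fun y => ∃ x, A.app x ∧ f x = y, by fun_prop⟩ : IFun M β Prop))
    (by fun_prop) ?_ fun A a ih => ?_
  · convert empty using 1
    ext x
    simp
  · convert ih.insert (f a) using 1
    ext x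
    simp [or_and_right, exists_or, eq_comm]

theorem exists_max {A : IFun M α Prop} (hA : IFin A) {f : α → RR M} (hf : Inn M f)
    (hne : ∃ a, A.app a) : ∃ a, A.app a ∧ ∀ b, A.app b → f b ≤ f a := by
  revert hne
  refine hA.induction (P := fun A => (∃ a, A.app a) → ∃ a, A.app a ∧ ∀ b, A.app b → f b ≤ f a)
    ?_ (by simp) fun A a ih _ => ?_
  · simp only [forall_iff_not_exists, imp_iff_not_or]
    fun_prop
  · by_cases hne : ∃ a, A.app a
    · obtain ⟨b, hb, hmax⟩ := ih hne
      rcases le_total (f a) (f b) with h | h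
      · refine ⟨b, by simp [hb], fun c hc => ?_⟩
        simp only [iInsert_app] at hc
        rcases hc with rfl | hc
        · exact h
        · exact hmax c hc
      · refine ⟨a, by simp, fun c hc => ?_⟩
        simp only [iInsert_app] at hc
        rcases hc with rfl | hc
        · exact le_rfl
        · exact (hmax c hc).trans h
    · refine ⟨a, by simp, fun c hc => ?_⟩
      simp only [iInsert_app] at hc
      rcases hc with rfl | hc
      · exact le_rfl
      · exact (hne ⟨c, hc⟩).elim

/-- This links inductive finiteness to the bijections with a natural number in `IsFin`. The
enumeration is total on `NN M` with irrelevant values from `n` on, so that it has a fixed function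
type; hence the need for an element of `α`. -/
theorem exists_enumeration [Nonempty α] {A : IFun M α Prop} (hA : IFin A) :
    ∃ n : NN M, ∃ f : IFun M (NN M) α, (∀ k, k < n → A.app (f.app k)) ∧
      (∀ j k, j < n → k < n → f.app j = f.app k → j = k) ∧
      ∀ a, A.app a → ∃ k, k < n ∧ f.app k = a := by
  classical
  refine hA.induction (P := fun A => ∃ n : NN M, ∃ f : IFun M (NN M) α,
    (∀ k, k < n → A.app (f.app k)) ∧ (∀ j k, j < n → k < n → f.app j = f.app k → j = k) ∧
      ∀ a, A.app a → ∃ k, k < n ∧ f.app k = a) ?_ ?_ ?_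
  · simp only [forall_iff_not_exists, imp_iff_not_or]
    fun_prop
  · obtain ⟨a⟩ := ‹Nonempty α›
    have h (k : NN M) : ¬ k < 0 := (NN.zero_le' k).not_gt
    exact ⟨0, ⟨fun _ => a, .const a⟩, by simp [h], by simp [h], by simp⟩
  · rintro A a ⟨n, f, h1, h2, h3⟩
    by_cases ha : A.app a
    · refine ⟨n, f, fun k hk => .inr (h1 k hk), h2, fun b hb => h3 b ?_⟩
      rcases hb with rfl | hb
      · exact ha
      · exact hb
    · have hlt {k : NN M} (hk : k < n + 1) (hne : k ≠ n) : k < n :=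
        lt_of_le_of_ne (NN.lt_add_one_iff.1 hk) hne
      refine ⟨n + 1, ⟨fun k => if k = n then a else f.app k, by fun_prop⟩, fun k hk => ?_,
        fun j k hj hk h => ?_, fun b hb => ?_⟩
      · by_cases hkn : k = n
        · simp [hkn]
        · simpa [hkn] using .inr (h1 k (hlt hk hkn))
      · by_cases hjn : j = n <;> by_cases hkn : k = n <;> simp only [IFun.app_mk, hjn, hkn,
          if_true, if_false] at h ⊢
        · exact (ha (h ▸ h1 k (hlt hk hkn))).elim
        · exact (ha (h ▸ h1 j (hlt hj hjn))).elim
        · exact h2 j k (hlt hj hjn) (hlt hk hkn) h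
      · simp only [iInsert_app] at hb
        rcases hb with rfl | hb
        · exact ⟨n, NN.lt_add_one_iff.2 le_rfl, by simp⟩
        · obtain ⟨k, hk, rfl⟩ := h3 b hb
          exact ⟨k, NN.lt_add_one_iff.2 hk.le, by simp [hk.ne]⟩

end IFin

end ZFModel

namespace ZFModel

open Code (dom code)

variable {M : Type u} [setLang.Structure M] [ZF M]
variable {α β γ δ : Type*} [Code M α] [Code M β] [Code M γ] [Code M δ]

/-! ### The space `c₀` -/

/-- The set of indices where `x` is at least `ε` in absolute value. -/
noncomputable def large (x : IFun M α (RR M)) (ε : RR M) : IFun M α Prop :=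
  ⟨fun d => ε ≤ |x.app d|, by fun_prop⟩

@[simp] theorem large_app (x : IFun M α (RR M)) (ε : RR M) (d : α) :
    (large x ε).app d = (ε ≤ |x.app d|) := rfl

@[fun_prop]
theorem inn_large {f : γ → IFun M α (RR M)} {g : γ → RR M} (hf : Inn M f) (hg : Inn M g) :
    Inn M fun c => large (f c) (g c) := by
  unfold large
  fun_prop

/-- `x` tends to zero along the finite sets. -/
def TendsZero (x : IFun M α (RR M)) : Prop := ∀ ε, 0 < ε → IFin (large x ε)

theorem TendsZero.of_le {x y : IFun M α (RR M)} {c : RR M} (hc : 0 < c)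
    (h : ∀ d, |y.app d| ≤ c * |x.app d|) (hx : TendsZero x) : TendsZero y := fun ε hε => by
  refine (hx (ε / c) (by positivity)).subset fun d hd => ?_
  simp only [large_app] at *
  rw [div_le_iff₀ hc]
  linarith [h d]

variable (M α) in
/-- The real functions of `M` on `α` that tend to zero along the finite sets. -/
noncomputable def c0 : Submodule (RR M) (α → RR M) where
  carrier := {x | ∃ h : Inn M x, TendsZero ⟨x, h⟩}
  zero_mem' := ⟨.const 0, fun ε hε => IFin.empty.subset fun d hd => by
    simp only [large_app, IFun.app_mk, Pi.zero_apply, abs_zero] at hd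
    exact (hd.not_gt hε).elim⟩
  add_mem' := by
    rintro x y ⟨hx, hx'⟩ ⟨hy, hy'⟩
    refine ⟨RR.inn_add hx hy, fun ε hε => ?_⟩
    refine ((hx' _ (half_pos hε)).union (hy' _ (half_pos hε))).subset fun d hd => ?_
    simp only [large_app, IFun.app_mk] at *
    by_contra! h
    have := hd.trans (abs_add_le (x d) (y d))
    linarith
  smul_mem' := by
    rintro c x ⟨hx, hx'⟩
    have h : Inn M fun d => c * x d := by fun_prop
    -- The extra `1` keeps the constant positive when `c = 0`.
    refine ⟨h, hx'.of_le (c := |c| + 1) (by positivity) fun d => ?_⟩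
    simp only [IFun.app_mk, Pi.smul_apply, smul_eq_mul]
    rw [abs_mul]
    gcongr
    linarith

namespace c0

/-- The underlying function. -/
noncomputable def toIFun (x : c0 M α) : IFun M α (RR M) := ⟨x.1, x.2.choose⟩

theorem tendsZero (x : c0 M α) : TendsZero (toIFun x) := x.2.choose_spec

/-- The values of an element of `c₀`. -/
noncomputable def ev (x : c0 M α) (d : α) : RR M := (toIFun x).app d

theorem ext {x y : c0 M α} (h : ∀ d, ev x d = ev y d) : x = y := Subtype.ext (funext h)

theorem inn_ev' (x : c0 M α) : Inn M (ev x) := .of_iFun (toIFun x)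

@[simp] theorem ev_add (x y : c0 M α) (d : α) : ev (x + y) d = ev x d + ev y d := rfl

@[simp] theorem ev_sub (x y : c0 M α) (d : α) : ev (x - y) d = ev x d - ev y d := rfl

@[simp] theorem ev_smul (c : RR M) (x : c0 M α) (d : α) : ev (c • x) d = c * ev x d := rfl

@[simp] theorem ev_zero (d : α) : ev (0 : c0 M α) d = 0 := rfl

/-- The element of `c₀` with given values. -/
noncomputable def mk (x : IFun M α (RR M)) (h : TendsZero x) : c0 M α :=
  ⟨x.app, .of_iFun x, h⟩

@[simp] theorem ev_mk (x : IFun M α (RR M)) (h : TendsZero x) (d : α) :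
    ev (mk x h) d = x.app d := rfl

theorem inn_range : Inn M fun x : IFun M α (RR M) => ∃ c : c0 M α, toIFun c = x := by
  refine Inn.congr_pred (Q := fun x => TendsZero x)
    (fun x => ⟨fun ⟨c, h⟩ => h ▸ tendsZero c, fun h => ⟨mk x h, rfl⟩⟩) ?_
  unfold TendsZero
  simp only [forall_iff_not_exists, imp_iff_not_or]
  fun_prop

noncomputable instance instCode : Code M (c0 M α) :=
  .ofInj toIFun (fun _ _ h => ext fun d => congrArg (fun f => f.app d) h) inn_range

@[fun_prop]
theorem inn_toIFun {f : γ → c0 M α} (hf : Inn M f) : Inn M fun a => toIFun (f a) := hf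

theorem inn_of_toIFun {f : γ → c0 M α} (hf : Inn M fun a => toIFun (f a)) : Inn M f := hf

attribute [irreducible] instCode

@[fun_prop]
theorem inn_ev {f : γ → c0 M α} {g : γ → α} (hf : Inn M f) (hg : Inn M g) :
    Inn M fun a => ev (f a) (g a) := by
  unfold ev
  fun_prop

theorem inn_of_ev {f : γ → c0 M α} (hf : Inn M fun p : γ × α => ev (f p.1) p.2) : Inn M f :=
  inn_of_toIFun (.iFunMk hf _)

/-- Only finitely many values have absolute value at least `1`. If there are any, the largest of
them is a bound; otherwise `1` is. -/
theorem exists_bound (x : c0 M α) : ∃ B, ∀ d, |ev x d| ≤ B := by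
  by_cases h : ∃ b, (large (toIFun x) 1).app b
  · obtain ⟨a, ha, hmax⟩ := (tendsZero x 1 one_pos).exists_max
      (f := fun d => |ev x d|) (RR.inn_abs (inn_ev' x)) h
    refine ⟨|ev x a|, fun d => ?_⟩
    rcases le_total 1 |ev x d| with h1 | h1
    · exact hmax d h1
    · exact h1.trans ha
  · push Not at h
    exact ⟨1, fun d => (not_le.1 (h d)).le⟩

theorem exists_norm (x : c0 M α) : ∃ c, ∀ b, c ≤ b ↔ 0 ≤ b ∧ ∀ d, |ev x d| ≤ b := by
  obtain ⟨B, hB⟩ := exists_bound x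
  -- Adjoining `0` keeps the set nonempty even when `α` is empty.
  obtain ⟨c, hc, hc'⟩ := RR.exists_isLUB (B := fun r => r = 0 ∨ ∃ d, |ev x d| = r) (by fun_prop)
    ⟨0, .inl rfl⟩ ⟨max 0 B, by
      rintro b (rfl | ⟨d, rfl⟩)
      · exact le_max_left _ _
      · exact (hB d).trans (le_max_right _ _)⟩
  refine ⟨c, fun b => ⟨fun h => ⟨(hc 0 (.inl rfl)).trans h, fun d =>
    (hc _ (.inr ⟨d, rfl⟩)).trans h⟩, fun h => hc' b ?_⟩⟩
  rintro r (rfl | ⟨d, rfl⟩)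
  · exact h.1
  · exact h.2 d

/-- The supremum norm. -/
noncomputable def norm (x : c0 M α) : RR M := (exists_norm x).choose

theorem norm_le_iff {x : c0 M α} {b : RR M} : norm x ≤ b ↔ 0 ≤ b ∧ ∀ d, |ev x d| ≤ b :=
  (exists_norm x).choose_spec b

theorem norm_nonneg (x : c0 M α) : 0 ≤ norm x := (norm_le_iff.1 le_rfl).1

theorem abs_ev_le (x : c0 M α) (d : α) : |ev x d| ≤ norm x := (norm_le_iff.1 le_rfl).2 d

@[fun_prop]
theorem inn_norm {f : γ → c0 M α} (hf : Inn M f) : Inn M fun a => norm (f a) := by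
  have : Inn M fun x : c0 M α => norm x := by
    refine .of_pred (R := fun x c => ∀ b, c ≤ b ↔ 0 ≤ b ∧ ∀ d, |ev x d| ≤ b) ?_ fun x c => ?_
    · simp only [forall_iff_not_exists]
      fun_prop
    · constructor
      · exact fun h => le_antisymm (norm_le_iff.2 ((h c).1 le_rfl))
          ((h _).2 ⟨norm_nonneg x, abs_ev_le x⟩)
      · rintro rfl b
        exact norm_le_iff
  exact this.comp hf

@[fun_prop]
theorem inn_add {f g : γ → c0 M α} (hf : Inn M f) (hg : Inn M g) : Inn M fun a => f a + g a :=
  inn_of_ev (by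
    simp only [ev_add]
    fun_prop)

@[fun_prop]
theorem inn_smul {f : γ → RR M} {g : γ → c0 M α} (hf : Inn M f) (hg : Inn M g) :
    Inn M fun a => f a • g a :=
  inn_of_ev (by
    simp only [ev_smul]
    fun_prop)

theorem norm_eq_zero {x : c0 M α} : norm x = 0 ↔ x = 0 := by
  constructor
  · exact fun h => ext fun d => abs_nonpos_iff.1 (h ▸ abs_ev_le x d)
  · rintro rfl
    exact le_antisymm (norm_le_iff.2 ⟨le_rfl, by simp⟩) (norm_nonneg _)

theorem norm_add_le (x y : c0 M α) : norm (x + y) ≤ norm x + norm y :=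
  norm_le_iff.2 ⟨add_nonneg (norm_nonneg x) (norm_nonneg y), fun d =>
    (abs_add_le _ _).trans (add_le_add (abs_ev_le x d) (abs_ev_le y d))⟩

theorem norm_smul_le (c : RR M) (x : c0 M α) : norm (c • x) ≤ |c| * norm x :=
  norm_le_iff.2 ⟨mul_nonneg (abs_nonneg c) (norm_nonneg x), fun d => by
    rw [ev_smul, abs_mul]
    exact mul_le_mul_of_nonneg_left (abs_ev_le x d) (abs_nonneg c)⟩

theorem norm_smul (c : RR M) (x : c0 M α) : norm (c • x) = |c| * norm x := by
  refine (norm_smul_le c x).antisymm ?_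
  rcases eq_or_ne c 0 with rfl | hc
  · simpa using norm_nonneg _
  · have h := norm_smul_le c⁻¹ (c • x)
    rw [inv_smul_smul₀ hc, abs_inv] at h
    rwa [← le_inv_mul_iff₀ (abs_pos.2 hc)]

/-- The pointwise limit is inner because limits are unique, and convergence to it is uniform by the
Cauchy condition in the norm. -/
theorem exists_limit {s : NN M → c0 M α} (hs : Inn M s)
    (hc : ∀ ε, 0 < ε → ∃ N, ∀ m n, N ≤ m → N ≤ n → norm (s m - s n) < ε) :
    ∃ x, ∀ ε, 0 < ε → ∃ N, ∀ n, N ≤ n → norm (s n - x) < ε := by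
  have hcd (d : α) : ∀ ε, 0 < ε → ∃ N, ∀ m n, N ≤ m → N ≤ n → |ev (s m) d - ev (s n) d| < ε :=
    fun ε hε => (hc ε hε).imp fun N hN m n hm hn =>
      (abs_ev_le (s m - s n) d).trans_lt (hN m n hm hn)
  choose x hx using fun d => RR.exists_limit (s := fun n => ev (s n) d) (by fun_prop) (hcd d)
  have hxinn : Inn M x := by
    refine .of_pred (R := fun d c => ∀ ε, 0 < ε → ∃ N, ∀ n, N ≤ n → |ev (s n) d - c| < ε) ?_
      fun d c => ⟨RR.limit_unique (hx d), ?_⟩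
    · simp only [forall_iff_not_exists, imp_iff_not_or]
      fun_prop
    · rintro rfl
      exact hx d
  -- The comparison index `K` may depend on `d`, whereas `N` does not; this gives uniformity.
  have key {ε : RR M} {N : NN M} (hε : 0 < ε) (hN : ∀ m n, N ≤ m → N ≤ n → norm (s m - s n) < ε)
      (n : NN M) (hn : N ≤ n) (d : α) : |ev (s n) d - x d| ≤ 2 * ε := by
    obtain ⟨K, hK⟩ := hx d ε hε
    have h1 := hK _ (le_max_right N K)
    have h2 := (abs_ev_le (s n - s (max N K)) d).trans_lt (hN n _ hn (le_max_left N K))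
    rw [ev_sub] at h2
    have := abs_sub_le (ev (s n) d) (ev (s (max N K)) d) (x d)
    linarith
  have htend : TendsZero ⟨x, hxinn⟩ := fun ε hε => by
    -- Then `s N` is within `ε / 2` of the limit everywhere, so where the limit is at least `ε` in
    -- absolute value, `s N` is at least `ε / 2`.
    obtain ⟨N, hN⟩ := hc (ε / 4) (by linarith)
    refine (tendsZero (s N) (ε / 2) (half_pos hε)).subset fun d hd => ?_
    have h1 := key (show 0 < ε / 4 by linarith) hN N le_rfl d
    simp only [large_app, IFun.app_mk] at hd ⊢
    change ε / 2 ≤ |ev (s N) d|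
    have := abs_sub_abs_le_abs_sub (x d) (ev (s N) d)
    rw [abs_sub_comm] at this
    linarith
  refine ⟨mk ⟨x, hxinn⟩ htend, fun ε hε => ?_⟩
  obtain ⟨N, hN⟩ := hc (ε / 3) (by linarith)
  refine ⟨N, fun n hn => lt_of_le_of_lt (norm_le_iff.2 ⟨?_, key ?_ hN n hn⟩) ?_⟩ <;> linarith

/-- Multiplication by `c` on the set of indices where `p` holds and by zero elsewhere. -/
noncomputable def restrict (p : IFun M α Prop) (c : RR M) : c0 M α →ₗ[RR M] c0 M α where
  toFun x := open Classical in mk ⟨fun d => if p.app d then c * ev x d else 0, by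
      have := inn_ev' x
      fun_prop⟩ ((tendsZero x).of_le (c := |c| + 1) (by positivity) fun d => by
        simp only [IFun.app_mk]
        change _ ≤ (|c| + 1) * |ev x d|
        split_ifs
        · rw [abs_mul]
          gcongr
          linarith
        · rw [abs_zero]
          positivity)
  map_add' x y := ext fun d => by
    simp only [ev_mk, IFun.app_mk, ev_add]
    split_ifs <;> ring
  map_smul' r x := ext fun d => by
    simp only [ev_mk, IFun.app_mk, ev_smul, RingHom.id_apply]
    split_ifs <;> ring

open Classical in
theorem ev_restrict (p : IFun M α Prop) (c : RR M) (x : c0 M α) (d : α) :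
    ev (restrict p c x) d = if p.app d then c * ev x d else 0 := rfl

theorem norm_restrict_le (p : IFun M α Prop) (c : RR M) (x : c0 M α) :
    norm (restrict p c x) ≤ |c| * norm x :=
  norm_le_iff.2 ⟨mul_nonneg (abs_nonneg c) (norm_nonneg x), fun d => by
    rw [ev_restrict]
    split_ifs
    · rw [abs_mul]
      exact mul_le_mul_of_nonneg_left (abs_ev_le x d) (abs_nonneg c)
    · rw [abs_zero]
      exact mul_nonneg (abs_nonneg c) (norm_nonneg x)⟩

@[fun_prop]
theorem inn_restrict {p : γ → IFun M α Prop} {c : γ → RR M} {x : γ → c0 M α} (hp : Inn M p)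
    (hc : Inn M c) (hx : Inn M x) : Inn M fun a => restrict (p a) (c a) (x a) :=
  inn_of_ev (by
    simp only [ev_restrict]
    fun_prop)

open Classical in
/-- The indicator of a point. -/
noncomputable def single (d : α) : c0 M α :=
  mk ⟨fun d' => if d' = d then 1 else 0, by fun_prop⟩ fun ε hε =>
    (IFin.empty.insert d).subset fun d' hd' => by
      by_cases h : d' = d
      · simp [h]
      · simp only [large_app, IFun.app_mk, h, if_false, abs_zero] at hd'
        exact (hd'.not_gt hε).elim

open Classical in
theorem ev_single (d d' : α) : ev (single d : c0 M α) d' = if d' = d then 1 else 0 := rfl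

theorem norm_single_le (d : α) : norm (single d : c0 M α) ≤ 1 := norm_le_iff.2 ⟨zero_le_one, by
  intro d'
  rw [ev_single]
  split_ifs <;> simp⟩

end c0
end ZFModel

namespace ZFModel

open Code (dom code)

variable {M : Type u} [setLang.Structure M] [ZF M]
variable {α β γ δ : Type*} [Code M α] [Code M β] [Code M γ] [Code M δ]

/-! ### Transport to the sets of codes -/

variable (M α) in
/-- The elements of the set of codes. -/
noncomputable def domEquiv : El (dom α : M) ≃ α where
  toFun x := ((Code.mem_dom x.1).1 x.2).choose
  invFun a := ⟨code a, code_mem a⟩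
  left_inv x := Subtype.ext ((Code.mem_dom x.1).1 x.2).choose_spec
  right_inv a := Code.inj ((Code.mem_dom (code a : M)).1 (code_mem a)).choose_spec

theorem code_domEquiv (x : El (dom α : M)) : code (domEquiv M α x) = x.1 :=
  ((Code.mem_dom x.1).1 x.2).choose_spec

theorem Inn.internal {f : α → β} (h : Inn M f) {F : El (dom α : M) → M}
    (hF : ∀ x, F x = code (f (domEquiv M α x))) : Internal F := by
  obtain ⟨g, hg⟩ := h
  refine ⟨g, fun p => ?_⟩
  simp only [isOPair_iff, hg, hF]
  constructor
  · rintro ⟨a, rfl⟩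
    exact ⟨(domEquiv M α).symm a, by rw [Equiv.apply_symm_apply]; rfl⟩
  · rintro ⟨x, rfl⟩
    exact ⟨domEquiv M α x, by rw [code_domEquiv]⟩

theorem Inn.internal₂ {f : α → β → γ} (h : Inn M fun p : α × β => f p.1 p.2)
    {F : El (dom α : M) → El (dom β : M) → M}
    (hF : ∀ x y, F x y = code (f (domEquiv M α x) (domEquiv M β y))) : Internal₂ F := by
  obtain ⟨g, hg⟩ := h
  refine ⟨g, fun p => ?_⟩
  simp only [isOPair_iff, hg, Prod.exists, exists_eq_left, hF]
  constructor
  · rintro ⟨a, b, rfl⟩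
    exact ⟨(domEquiv M α).symm a, (domEquiv M β).symm b, by
      simp only [Equiv.apply_symm_apply]; rfl⟩
  · rintro ⟨x, y, rfl⟩
    exact ⟨domEquiv M α x, domEquiv M β y, by rw [code_prod, code_domEquiv, code_domEquiv]⟩

theorem Inn.internalRel {r : α → β → Prop} (h : Inn M fun p : α × β => r p.1 p.2) :
    InternalRel fun (x : El (dom α : M)) (y : El (dom β : M)) =>
      r (domEquiv M α x) (domEquiv M β y) := by
  obtain ⟨g, hg⟩ := h.exists_set
  refine ⟨g, fun p => ?_⟩
  simp only [isOPair_iff, hg, Prod.exists]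
  constructor
  · rintro ⟨a, b, h, rfl⟩
    exact ⟨(domEquiv M α).symm a, (domEquiv M β).symm b, by simpa, rfl⟩
  · rintro ⟨x, y, h, rfl⟩
    exact ⟨_, _, h, by rw [code_prod, code_domEquiv, code_domEquiv]⟩

theorem inn_of_internalSet {B : Set (El (dom α : M))} (h : InternalSet B) :
    Inn M fun a : α => (domEquiv M α).symm a ∈ B := by
  obtain ⟨b, hb⟩ := h
  refine .of_exists_set b fun a => ?_
  rw [hb]
  constructor
  · rintro ⟨y, hy, h⟩
    rwa [show (domEquiv M α).symm a = y from Subtype.ext h]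
  · exact fun h => ⟨_, h, rfl⟩

/-- The uniform boundedness principle for endomorphisms of a coded Banach space. -/
theorem UBP.exists_bound (hUBP : UBP M) {X : Type*} [Code M X] [AddCommGroup X]
    [Module (RR M) X] (nX : X → RR M) (hadd : Inn M fun p : X × X => p.1 + p.2)
    (hsmul : Inn M fun p : RR M × X => p.1 • p.2) (hnorm : Inn M nX)
    (norm_eq_zero : ∀ x, nX x = 0 ↔ x = 0) (norm_add_le : ∀ x y, nX (x + y) ≤ nX x + nX y)
    (norm_smul : ∀ (c : RR M) x, nX (c • x) = |c| * nX x)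
    (complete : ∀ s : NN M → X, Inn M s →
      (∀ ε, 0 < ε → ∃ N, ∀ m n, N ≤ m → N ≤ n → nX (s m - s n) < ε) →
      ∃ x, ∀ ε, 0 < ε → ∃ N, ∀ n, N ≤ n → nX (s n - x) < ε)
    (T : NN M → X →ₗ[RR M] X) (hT : Inn M fun p : NN M × X => T p.1 p.2)
    (bound : ∀ n, ∃ C, 0 < C ∧ ∀ x, nX (T n x) ≤ C * nX x)
    (pointwise : ∀ x, ∃ C, ∀ n, nX (T n x) ≤ C) :
    ∃ C, ∀ n x, nX x ≤ 1 → nX (T n x) ≤ C := by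
  -- The principle speaks about elements of sets of `M`, so all structure is transported along the
  -- bijections with the sets of codes.
  let e := domEquiv M (RR M)
  let eX := domEquiv M X
  let _ : Field (El (dom (RR M) : M)) := e.field
  let _ : LinearOrder (El (dom (RR M) : M)) := LinearOrder.lift' e e.injective
  let _ : AddCommGroup (El (dom X : M)) := eX.addCommGroup
  have h0 : e 0 = 0 := e.apply_symm_apply _
  have h1 : e 1 = 1 := e.apply_symm_apply _
  have hea (a b) : e (a + b) = e a + e b := e.apply_symm_apply _
  have hem (a b) : e (a * b) = e a * e b := e.apply_symm_apply _
  have hen (a) : e (-a) = -e a := e.apply_symm_apply _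
  have hele {a b} : a ≤ b ↔ e a ≤ e b := Iff.rfl
  have helt {a b} : a < b ↔ e a < e b := lt_iff_lt_of_le_iff_le hele
  have hXa (x y) : eX (x + y) = eX x + eX y := eX.apply_symm_apply _
  have hXs (x y) : eX (x - y) = eX x - eX y := eX.apply_symm_apply _
  have hX0 : eX 0 = 0 := eX.apply_symm_apply _
  have : IsStrictOrderedRing (El (dom (RR M) : M)) :=
    Function.Injective.isStrictOrderedRing e h0 h1 hea hem hele helt
  let _ : SMul (El (dom (RR M) : M)) (El (dom X : M)) := ⟨fun c x => eX.symm (e c • eX x)⟩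
  have hXm (c : El (dom (RR M) : M)) (x : El (dom X : M)) : eX (c • x) = e c • eX x :=
    eX.apply_symm_apply _
  let _ : Module (El (dom (RR M) : M)) (El (dom X : M)) :=
    { one_smul := fun x => eX.injective (by rw [hXm, h1, one_smul])
      mul_smul := fun c d x => eX.injective (by rw [hXm, hXm, hXm, hem, mul_smul])
      smul_zero := fun c => eX.injective (by rw [hXm, hX0, smul_zero])
      smul_add := fun c x y => eX.injective (by rw [hXm, hXa, hXa, hXm, hXm, smul_add])
      add_smul := fun c d x => eX.injective (by rw [hXm, hXa, hXm, hXm, hea, add_smul])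
      zero_smul := fun x => eX.injective (by rw [hXm, hX0, h0, zero_smul]) }
  have habs (a) : e |a| = |e a| := by
    rcases le_total 0 a with h | h
    · rw [abs_of_nonneg h, abs_of_nonneg (by rw [← h0]; exact h)]
    · rw [abs_of_nonpos h, abs_of_nonpos (by rw [← h0]; exact h), hen]
  have hval (a : El (dom (RR M) : M)) : a.1 = code (e a) := (code_domEquiv a).symm
  have hvalX (a : El (dom X : M)) : a.1 = code (eX a) := (code_domEquiv a).symm
  have hR : IsRealField (dom (RR M) : M) :=
    { internal_add := Inn.internal₂ (f := fun x y : RR M => x + y) (by fun_prop)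
        fun x y => by rw [hval, hea]
      internal_mul := Inn.internal₂ (f := fun x y : RR M => x * y) (by fun_prop)
        fun x y => by rw [hval, hem]
      internal_le := Inn.internalRel (r := fun x y : RR M => x ≤ y) (by fun_prop)
      exists_isLUB := fun B hB hne hbdd => by
        obtain ⟨c, hc, hc'⟩ := RR.exists_isLUB (inn_of_internalSet hB)
          (hne.elim fun b hb => ⟨e b, by simpa [e] using hb⟩)
          (hbdd.elim fun u hu => ⟨e u, fun b hb => by simpa [e] using hele.1 (hu hb)⟩)
        refine ⟨e.symm c, fun b hb => hele.2 ?_, fun u hu => hele.2 ?_⟩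
        · simpa using hc (e b) (by simpa [e] using hb)
        · rw [Equiv.apply_symm_apply]
          exact hc' (e u) fun b hb => by simpa [e] using hele.1 (hu hb) }
  let nX' : El (dom X : M) → El (dom (RR M) : M) := fun x => e.symm (nX (eX x))
  have hn (x) : e (nX' x) = nX (eX x) := e.apply_symm_apply _
  have hX : IsBanachSpace (dom (RR M) : M) (dom X) nX' :=
    { internal_add := Inn.internal₂ (f := fun x y : X => x + y) hadd fun x y => by
        rw [hvalX, hXa]
      internal_smul := Inn.internal₂ (f := fun (c : RR M) (x : X) => c • x) hsmul fun c x => by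
        rw [hvalX, hXm]
      internal_norm := Inn.internal hnorm fun x => rfl
      norm_eq_zero := fun x => by
        rw [← e.injective.eq_iff, hn, h0, norm_eq_zero, ← hX0, eX.injective.eq_iff]
      norm_add_le := fun x y => by
        rw [hele, hea, hn, hn, hn, hXa]
        exact norm_add_le _ _
      norm_smul := fun c x => e.injective (by rw [hem, habs, hn, hn, hXm, norm_smul])
      complete := fun w hw s hs hc => by
        obtain rfl := hw.eq isOmega_omega
        obtain ⟨x, hx⟩ := complete (fun n => eX (s n)) (by
          obtain ⟨g, hg⟩ := hs
          refine ⟨g, fun p => (hg p).trans ?_⟩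
          simp only [isOPair_iff, hvalX]
          rfl) fun ε hε => by
            obtain ⟨N, hN⟩ := hc (e.symm ε) (by rwa [helt, h0, e.apply_symm_apply])
            refine ⟨N, fun m n hm hn' => ?_⟩
            have := hN m n (NN.natLE_iff.2 hm) (NN.natLE_iff.2 hn')
            rwa [helt, hn, e.apply_symm_apply, hXs] at this
        refine ⟨eX.symm x, fun ε hε => ?_⟩
        obtain ⟨N, hN⟩ := hx (e ε) (by rwa [helt, h0] at hε)
        refine ⟨N, fun n hn' => ?_⟩
        rw [helt, hn, hXs, eX.apply_symm_apply]
        exact hN n (NN.natLE_iff.1 hn') }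
  let T' : NN M → El (dom X : M) →ₗ[El (dom (RR M) : M)] El (dom X : M) := fun n =>
    { toFun := fun x => eX.symm (T n (eX x))
      map_add' := fun x y => eX.injective (by
        simp only [hXa, map_add, Equiv.apply_symm_apply])
      map_smul' := fun c x => eX.injective (by
        simp only [hXm, map_smul, Equiv.apply_symm_apply, RingHom.id_apply]) }
  have hT' (n x) : eX (T' n x) = T n (eX x) := eX.apply_symm_apply _
  obtain ⟨C, hC⟩ := hUBP (dom (RR M)) hR (dom X) nX' hX (dom X) nX' hX.toIsNormedSpace (omega M) T'
    (by
      obtain ⟨g, hg⟩ := hT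
      refine ⟨g, fun p => ?_⟩
      simp only [isOPair_iff, hg, Prod.exists, exists_eq_left, hvalX, hT']
      constructor
      · rintro ⟨n, x, rfl⟩
        exact ⟨n, eX.symm x, by rw [eX.apply_symm_apply]; rfl⟩
      · rintro ⟨n, x, rfl⟩
        exact ⟨n, eX x, rfl⟩)
    (fun n x ε hε => by
      obtain ⟨C, hC, hC'⟩ := bound n
      have hε' : 0 < e ε := by rwa [helt, h0] at hε
      -- Continuity from the Lipschitz bound, with `δ = ε / C`.
      refine ⟨e.symm (e ε / C), by rw [helt, h0, e.apply_symm_apply]; positivity, fun y hy => ?_⟩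
      rw [helt, hn, e.apply_symm_apply, hXs, lt_div_iff₀ hC] at hy
      rw [helt, hn, ← map_sub, hT', hXs]
      linarith [hC' (eX y - eX x)])
    (fun x => (pointwise (eX x)).imp' e.symm fun C hC n => by
      rw [hele, hn, hT', e.apply_symm_apply]
      exact hC n)
  refine ⟨e C, fun n x hx => ?_⟩
  obtain ⟨c, hc, hcC⟩ := hC n
  have := (hc.1 ⟨eX.symm x, by rwa [hele, hn, h1, eX.apply_symm_apply], rfl⟩).trans hcC
  rwa [hele, hn, hT', eX.apply_symm_apply] at this

end ZFModel

/-! ### From uniform boundedness to multiple choice. -/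

namespace ZFModel

open Code (dom code)

variable {M : Type u} [setLang.Structure M] [ZF M]
variable {α β γ δ : Type*} [Code M α] [Code M β] [Code M γ] [Code M δ]

/-- If the uniform boundedness principle holds, every partition into countably many nonempty sets
carries an element of `c₀` that does not vanish on infinitely many of them. -/
theorem UBP.exists_c0 (hUBP : UBP M) {ν : α → NN M} (hν : Inn M ν)
    (hs : Function.Surjective ν) :
    ∃ x : c0 M α, ∀ k, ∃ n, k ≤ n ∧ ∃ d, ν d = n ∧ c0.ev x d ≠ 0 := by
  -- Now each `x` vanishes on all blocks from some index `k` on, where `k` depends on `x`.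
  by_contra! H
  let p : NN M → IFun M α Prop := fun n => ⟨fun d => ν d = n, by fun_prop⟩
  have hp : Inn M p := by
    refine .iFunMk ?_ _
    fun_prop
  let a : NN M → RR M := fun n => RR.of (QQ.of n)
  have ha (n : NN M) : 0 ≤ a n := by
    rw [← map_zero RR.of]
    exact RR.of_le_of.2 (QQ.of_nonneg n)
  have hmono {m n : NN M} (h : m ≤ n) : a m ≤ a n := RR.of_le_of.2 (QQ.of_le_of.2 h)
  have hT (n : NN M) (x : c0 M α) : c0.norm (c0.restrict (p n) (a n) x) ≤ a n * c0.norm x := by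
    simpa [abs_of_nonneg (ha n)] using c0.norm_restrict_le (p n) (a n) x
  obtain ⟨C, hC⟩ := hUBP.exists_bound (X := c0 M α) c0.norm (by fun_prop) (by fun_prop)
    (by fun_prop) (fun x => c0.norm_eq_zero) c0.norm_add_le c0.norm_smul
    (fun s hs hc => c0.exists_limit hs hc) (fun n => c0.restrict (p n) (a n)) (by fun_prop)
    (fun n => ⟨a n + 1, by linarith [ha n], fun x => (hT n x).trans (by
      gcongr
      · exact c0.norm_nonneg x
      · linarith)⟩)
    (fun x => by
      -- For `n ≥ k` the image of `x` is zero, and for `n ≤ k` its norm is at most `k` times that of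
      -- `x`.
      obtain ⟨k, hk⟩ := H x
      refine ⟨a k * c0.norm x, fun n => ?_⟩
      rcases le_total k n with h | h
      · refine c0.norm_le_iff.2 ⟨mul_nonneg (ha k) (c0.norm_nonneg x), fun d => ?_⟩
        rw [c0.ev_restrict]
        split_ifs with hd
        · rw [hk n h d hd, mul_zero, abs_zero]
          exact mul_nonneg (ha k) (c0.norm_nonneg x)
        · rw [abs_zero]
          exact mul_nonneg (ha k) (c0.norm_nonneg x)
      · exact (hT n x).trans (mul_le_mul_of_nonneg_right (hmono h) (c0.norm_nonneg x)))
  -- The indicator of a point of block `n` has norm at most `1` and is mapped to a function with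
  -- value `n` at that point, while `n > C`.
  obtain ⟨n, hn⟩ := RR.exists_le_nat (C + 1)
  obtain ⟨d, hd⟩ := hs n
  have h1 := (c0.abs_ev_le _ d).trans (hC n (c0.single d) (c0.norm_single_le d))
  rw [c0.ev_restrict, if_pos (show (p n).app d from hd), c0.ev_single, if_pos rfl, mul_one,
    abs_of_nonneg (ha n)] at h1
  simp only [a] at h1
  linarith

/-- Multiple choice for infinitely many members of a countable partition. -/
theorem UBP.exists_finite (hUBP : UBP M) {ν : α → NN M} (hν : Inn M ν)
    (hs : Function.Surjective ν) :
    ∃ G : NN M → IFun M α Prop, Inn M G ∧ (∀ n d, (G n).app d → ν d = n) ∧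
      (∀ n, IFin (G n)) ∧ ∀ k, ∃ n, k ≤ n ∧ ∃ d, (G n).app d := by
  obtain ⟨x, hx⟩ := hUBP.exists_c0 hν hs
  have hxi := c0.inn_ev' x
  -- The set for block `n` consists of the points where `|x|` attains its maximum over the block,
  -- provided this maximum is not zero.
  have hG : Inn M fun p : NN M × α => ν p.2 = p.1 ∧ c0.ev x p.2 ≠ 0 ∧
      ∀ d, ν d = p.1 → |c0.ev x d| ≤ |c0.ev x p.2| := by
    simp only [forall_iff_not_exists, imp_iff_not_or, Ne]
    fun_prop
  refine ⟨fun n => ⟨_, Inn.of_curry (f := fun n d' => ν d' = n ∧ c0.ev x d' ≠ 0 ∧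
      ∀ d, ν d = n → |c0.ev x d| ≤ |c0.ev x d'|) hG n⟩, .iFunMk hG _, fun n d h => h.1,
    fun n => ?_, fun k => ?_⟩
  · by_cases h : ∃ d, ν d = n ∧ c0.ev x d ≠ 0
    · obtain ⟨d, hd, hne⟩ := h
      exact (c0.tendsZero x _ (abs_pos.2 hne)).subset fun d' h' => h'.2.2 d hd
    · exact IFin.empty.subset fun d h' => h ⟨d, h'.1, h'.2.1⟩
  · obtain ⟨n, hkn, d, hd, hne⟩ := hx k
    -- The block may be infinite, but only finitely many of its points have a value as large as the
    -- one at `d`; a maximum among these is one over the whole block.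
    have hfin : IFin (⟨fun d' => ν d' = n ∧ |c0.ev x d| ≤ |c0.ev x d'|, by fun_prop⟩ :
        IFun M α Prop) :=
      (c0.tendsZero x _ (abs_pos.2 hne)).subset fun d' h' => h'.2
    obtain ⟨b, hb, hmax⟩ := hfin.exists_max (f := fun d => |c0.ev x d|) (by fun_prop)
      ⟨d, hd, le_rfl⟩
    refine ⟨n, hkn, b, hb.1, fun h0 => ?_, fun d' hd' => ?_⟩
    · have := hb.2
      rw [h0, abs_zero] at this
      exact hne (abs_nonpos_iff.1 this)
    · rcases le_total |c0.ev x d| |c0.ev x d'| with h | h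
      · exact hmax d' ⟨hd', h⟩
      · exact h.trans hb.2

/-- A sequence whose terms with index at most `p.1` are chosen from the sets `S n`. -/
structure PartialChoice (S : IFun M (NN M × α) Prop) where
  /-- The bound and the sequence. -/
  toProd : NN M × IFun M (NN M) α
  spec : ∀ k, k ≤ toProd.1 → S.app (k, toProd.2.app k)

namespace PartialChoice

variable (S : IFun M (NN M × α) Prop)

theorem toProd_injective : Function.Injective (toProd (S := S)) := fun x y h => by
  cases x
  cases y
  congr

theorem inn_spec :
    Inn M fun p : NN M × IFun M (NN M) α => ∀ k, k ≤ p.1 → S.app (k, p.2.app k) := by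
  simp only [forall_iff_not_exists, imp_iff_not_or]
  fun_prop

noncomputable instance : Code M (PartialChoice S) :=
  .ofInj toProd (toProd_injective S)
    ((inn_spec S).congr_pred fun p => ⟨fun ⟨d, h⟩ => h ▸ d.spec, fun h => ⟨⟨p, h⟩, rfl⟩⟩)

@[fun_prop]
theorem inn_toProd {f : γ → PartialChoice S} (hf : Inn M f) : Inn M fun c => (f c).toProd := hf

/-- Finite choice, by induction in `M`. It makes every block of the partition of partial choices by
their bound nonempty. -/
theorem exists_eq (hne : ∀ n, ∃ a, S.app (n, a)) (n : NN M) :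
    ∃ d : PartialChoice S, d.toProd.1 = n := by
  classical
  have h : ∃ f : IFun M (NN M) α, ∀ k, k ≤ n → S.app (k, f.app k) := by
    induction n using NN.induction with
    | hP => exact .ex ((inn_spec S).comp (by fun_prop))
    | h0 =>
      obtain ⟨a, ha⟩ := hne 0
      refine ⟨⟨fun _ => a, .const a⟩, fun k hk => ?_⟩
      rw [show k = 0 from le_antisymm hk (NN.zero_le' k)]
      exact ha
    | hs n ih =>
      obtain ⟨f, hf⟩ := ih
      obtain ⟨a, ha⟩ := hne (n + 1)
      refine ⟨⟨fun k => if k = n + 1 then a else f.app k, by fun_prop⟩, fun k hk => ?_⟩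
      simp only [IFun.app_mk]
      split_ifs with h
      · rwa [h]
      · exact hf k (NN.lt_add_one_iff.1 (lt_of_le_of_ne hk h))
  obtain ⟨f, hf⟩ := h
  exact ⟨⟨(n, f), hf⟩, rfl⟩

end PartialChoice

/-- Countable multiple choice for inner families. -/
theorem UBP.exists_multipleChoice (hUBP : UBP M) (S : IFun M (NN M × α) Prop)
    (hne : ∀ n, ∃ a, S.app (n, a)) :
    ∃ H : NN M → IFun M α Prop, Inn M H ∧
      ∀ n, IFin (H n) ∧ (∃ a, (H n).app a) ∧ ∀ a, (H n).app a → S.app (n, a) := by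
  obtain ⟨G, hG, hGn, hGfin, hGinf⟩ := hUBP.exists_finite
    (ν := fun d : PartialChoice S => d.toProd.1) (by fun_prop) (PartialChoice.exists_eq S hne)
  -- The least index from `k` on with a nonempty finite set. Its partial choices reach at least to
  -- `k`, so their `k`-th terms lie in the `k`-th set.
  let R : NN M → NN M → Prop := fun k n => k ≤ n ∧ (∃ d, (G n).app d) ∧
    ∀ m, k ≤ m → (∃ d, (G m).app d) → n ≤ m
  have hR : Inn M fun p : NN M × NN M => R p.1 p.2 := by
    simp only [R, forall_iff_not_exists, imp_iff_not_or]
    fun_prop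
  have hRex (k : NN M) : ∃ n, R k n := by
    obtain ⟨n, hn, hn'⟩ := NN.exists_least (P := fun n => k ≤ n ∧ ∃ d, (G n).app d) (by fun_prop)
      (hGinf k)
    exact ⟨n, hn.1, hn.2, fun m h h' => hn' m ⟨h, h'⟩⟩
  choose ν hν using hRex
  have hνinn : Inn M ν := .of_pred hR fun k n => ⟨fun h =>
    le_antisymm ((hν k).2.2 n h.1 h.2.1) (h.2.2 _ (hν k).1 (hν k).2.1), fun h => h ▸ hν k⟩
  refine ⟨fun k => ⟨fun a => ∃ d, (G (ν k)).app d ∧ d.toProd.2.app k = a, by fun_prop⟩,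
    by fun_prop, fun k => ⟨?_, ?_, ?_⟩⟩
  · exact (hGfin (ν k)).image (f := fun d : PartialChoice S => d.toProd.2.app k) (by fun_prop)
  · obtain ⟨d, hd⟩ := (hν k).2.1
    exact ⟨_, d, hd, rfl⟩
  · rintro a ⟨d, hd, rfl⟩
    refine d.spec k ?_
    rw [hGn _ d hd]
    exact (hν k).1

/-! ### Multiple choice in the model -/

@[fun_prop]
theorem inn_mem {a b : M} {f : γ → El a} {g : γ → El b} (hf : Inn M f) (hg : Inn M g) :
    Inn M fun c => (f c).1 ∈ₘ (g c).1 := by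
  have h : Inn M fun p : El a × El b => p.1.1 ∈ₘ p.2.1 :=
    .of_dfn_pred (fun p => ∃ x y, IsOPair p x y ∧ x ∈ₘ y) (by
      repeat' first
        | exact .var _ | apply Dfn.isOPair | apply Dfn.mem | apply Dfn.and | apply Dfn.ex)
      fun p => by
        simp only [isOPair_iff, code_prod, opair_inj]
        constructor
        · rintro ⟨_, _, ⟨rfl, rfl⟩, h⟩
          exact h
        · exact fun h => ⟨_, _, ⟨rfl, rfl⟩, h⟩
  exact h.comp (hf.prodMk hg)

theorem internal_iff_inn {a : M} {f : El a → β} : Internal (fun x => code (f x)) ↔ Inn M f := by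
  simp only [Internal, isOPair_iff]
  rfl

theorem NN.subset_omega (n : NN M) : ∀ x, x ∈ₘ n.1 → x ∈ₘ omega M := by
  induction n using induct with
  | hP =>
    refine .of_dfn_pred (fun n => ∀ x, x ∈ₘ n → x ∈ₘ omega M) ?_ fun n => Iff.rfl
    repeat' first
      | exact .var _ | exact .par _ | apply Dfn.mem | apply Dfn.imp | apply Dfn.all
  | h0 => exact fun x h => (not_mem_zero x h).elim
  | hs n ih =>
    intro x hx
    rcases mem_succ.1 hx with h | rfl
    · exact ih x h
    · exact n.2

/-- An inner function from a natural number to `ω` is bounded, hence not surjective. -/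
theorem not_isFin_omega : ¬ IsFin (omega M) := by
  rintro ⟨w, hw, n, f, hf, -, hsurj⟩
  obtain rfl := hw.eq isOmega_omega
  have hf : Inn M f := internal_iff_inn.1 hf
  -- The induction runs over initial segments `j` with the domain `n` fixed; for `j` outside `n` the
  -- step adds no new argument.
  have key (j : NN M) : ∃ b, ∀ k : El n.1, k.1 ∈ₘ j.1 → f k < b := by
    induction j using NN.induct with
    | hP =>
      simp only [forall_iff_not_exists, imp_iff_not_or]
      fun_prop
    | h0 => exact ⟨0, fun k hk => (NN.not_mem_zero _ hk).elim⟩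
    | hs j ih =>
      obtain ⟨b, hb⟩ := ih
      by_cases hj : j.1 ∈ₘ n.1
      · refine ⟨max b (f ⟨j.1, hj⟩ + 1), fun k hk => ?_⟩
        rcases NN.mem_succ.1 hk with h | h
        · exact (hb k h).trans_le (le_max_left _ _)
        · rw [show k = ⟨j.1, hj⟩ from Subtype.ext h]
          exact (NN.lt_add_one_iff.2 le_rfl).trans_le (le_max_right _ _)
      · refine ⟨b, fun k hk => hb k ((NN.mem_succ.1 hk).resolve_right fun h => hj ?_)⟩
        rw [← h]
        exact k.2
  obtain ⟨b, hb⟩ := key n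
  obtain ⟨k, hk⟩ := hsurj b
  exact (hb k k.2).ne hk

/-- The set of `M` with given elements. -/
noncomputable def toSet (A : IFun M α Prop) : M :=
  (Inn.of_iFun A).exists_set.choose

theorem mem_toSet {A : IFun M α Prop} {x : M} : x ∈ₘ toSet A ↔ ∃ a, A.app a ∧ x = code a :=
  (Inn.of_iFun A).exists_set.choose_spec x

/-- The values all lie in the power set of the set of codes, so the family is a function between
coded types and definability of its graph suffices. -/
theorem internal_toSet {a : M} {A : El a → IFun M α Prop} (hA : Inn M A) :
    Internal fun c => toSet (A c) := by
  obtain ⟨p, hp⟩ := ZF.out.powerset (dom α : M)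
  let f : El a → El p := fun c => ⟨toSet (A c), (hp _).2 fun x hx => by
    obtain ⟨b, -, rfl⟩ := mem_toSet.1 hx
    exact code_mem b⟩
  have hf : Inn M f := .of_dfn
    (fun c y => ∃ h, PairMem (graph M A hA) c h ∧ ∀ x, x ∈ₘ y ↔ PairMem h x (code True)) (by
      repeat' first
        | exact .var _ | exact .par _ | apply Dfn.pairMem | apply Dfn.mem | apply Dfn.iff
        | apply Dfn.and | apply Dfn.ex | apply Dfn.all) fun c y => by
      have h1 (x : M) : PairMem (code (A c)) x (code True) ↔ x ∈ₘ toSet (A c) := by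
        rw [pairMem_code, mem_toSet]
        simp only [eq_comm (a := (code True : M)), code_eq_true, and_comm]
      have h2 (h : M) : PairMem (graph M A hA) (code c) h ↔ h = code (A c) := by
        rw [pairMem_graph]
        simp
      simp only [h2, exists_eq_left, h1]
      constructor
      · exact fun h => Subtype.ext (ext_mem fun x => (h x).symm)
      · rintro rfl x
        exact Iff.rfl
  exact internal_iff_inn.2 hf

theorem isFin_toSet [Nonempty α] {A : IFun M α Prop} (hA : IFin A) : IsFin (toSet A) := by
  obtain ⟨n, f, h1, h2, h3⟩ := hA.exists_enumeration
  let ι : El n.1 → NN M := fun k => ⟨k.1, NN.subset_omega n _ k.2⟩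
  have hι : Inn M ι := .of_dfn (fun x y => x = y) (Dfn.eq (.var _) (.var _)) fun a b =>
    ⟨fun h => Subtype.ext h, fun h => congrArg Subtype.val h⟩
  have hlt (k : El n.1) : ι k < n := NN.mem_iff_lt.1 k.2
  refine ⟨omega M, isOmega_omega, n,
    fun k => ⟨code (f.app (ι k)), mem_toSet.2 ⟨_, h1 _ (hlt k), rfl⟩⟩, ?_, ?_, ?_⟩
  · exact internal_iff_inn.2 (by fun_prop : Inn M fun k => f.app (ι k))
  · intro j k h
    have := h2 _ _ (hlt j) (hlt k) (code_inj.1 (congrArg Subtype.val h))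
    exact Subtype.ext (show j.1 = k.1 from congrArg (fun z : NN M => z.1) this)
  · rintro ⟨x, hx⟩
    obtain ⟨a, ha, rfl⟩ := mem_toSet.1 hx
    obtain ⟨k, hk, rfl⟩ := h3 a ha
    exact ⟨⟨k.1, NN.mem_iff_lt.2 hk⟩, rfl⟩

/-- An element of `S n` is reached from the graph by three unions, through the pair, then `{n, S
n}`, then `S n`. -/
theorem exists_superset {a : M} {S : El a → M} (hS : Internal S) : ∃ u : M, ∀ n, S n ⊆ₘ u := by
  obtain ⟨g, hg⟩ := hS
  obtain ⟨u₁, h₁⟩ := ZF.out.union g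
  obtain ⟨u₂, h₂⟩ := ZF.out.union u₁
  obtain ⟨u₃, h₃⟩ := ZF.out.union u₂
  refine ⟨u₃, fun n x hx => (h₃ x).2 ⟨S n, ?_, hx⟩⟩
  obtain ⟨d, hd⟩ := ZF.out.pairing n.1 (S n)
  have hp : IsOPair (opair n.1 (S n)) n.1 (S n) := isOPair_iff.2 rfl
  exact (h₂ _).2 ⟨d, (h₁ _).2 ⟨_, (hg _).2 ⟨n, hp⟩, (hp d).2 (.inr hd)⟩, (hd _).2 (.inr rfl)⟩

/-- All the sets `S n` lie in one set `u`, so the sequence becomes an inner relation between `NN M`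
and `El u`, to which multiple choice for inner families applies. -/
theorem UBP.cmc (hUBP : UBP M) : CMC M := by
  intro w hw S hS hne
  obtain rfl := hw.eq isOmega_omega
  obtain ⟨u, hu⟩ := exists_superset hS
  have hne' (n : NN M) : ∃ a : El u, a.1 ∈ₘ S n := (hne n).elim fun x hx => ⟨⟨x, hu n x hx⟩, hx⟩
  have : Nonempty (El u) := (hne' 0).nonempty
  have hS' : Inn M fun p : NN M × El u => p.2.1 ∈ₘ S p.1 := by
    obtain ⟨g, hg⟩ := hS
    refine .of_dfn_pred (fun p => ∃ n s y, IsOPair p n s ∧ PairMem g n y ∧ s ∈ₘ y) (by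
      repeat' first
        | exact .var _ | exact .par _ | apply Dfn.isOPair | apply Dfn.pairMem | apply Dfn.mem
        | apply Dfn.and | apply Dfn.ex) fun p => ?_
    simp only [pairMem_iff, hg, isOPair_iff, code_prod, opair_inj]
    constructor
    · rintro ⟨_, _, _, ⟨rfl, rfl⟩, ⟨n, h, rfl⟩, h'⟩
      rwa [show p.1 = n from Subtype.ext h]
    · exact fun h => ⟨_, _, _, ⟨rfl, rfl⟩, ⟨p.1, rfl, rfl⟩, h⟩
  obtain ⟨H, hH, hH'⟩ := hUBP.exists_multipleChoice ⟨_, hS'⟩ hne'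
  refine ⟨fun n => toSet (H n), internal_toSet hH, fun n => ⟨?_, fun x hx => ?_, ?_⟩⟩
  · obtain ⟨a, ha⟩ := (hH' n).2.1
    exact ⟨_, mem_toSet.2 ⟨a, ha, rfl⟩⟩
  · obtain ⟨a, ha, rfl⟩ := mem_toSet.1 hx
    exact (hH' n).2.2 a ha
  · exact isFin_toSet (hH' n).1

theorem CMC.pcmc (h : CMC M) : PCMC M := by
  intro w hw S hS hne
  obtain rfl := hw.eq isOmega_omega
  obtain ⟨F, hF, hF'⟩ := h _ hw S hS hne
  exact ⟨_, fun _ h => h, not_isFin_omega, F, hF, hF'⟩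

theorem CMC.finiteSubsetSelection (h : CMC M) : FiniteSubsetSelection M := by
  intro w hw S hS hne
  obtain rfl := hw.eq isOmega_omega
  obtain ⟨F, hF, hF'⟩ := h _ hw S hS hne
  refine ⟨F, hF, fun n => (hF' n).2, omega M, fun x => ⟨fun hx => ⟨⟨x, hx⟩, rfl, (hF' _).1⟩, ?_⟩,
    not_isFin_omega⟩
  rintro ⟨n, rfl, -⟩
  exact n.2

end ZFModel

theorem mainTheorem5 (M : Type u) [ZFModel.setLang.Structure M] (hZF : ZFModel.IsZF M)
    (hUBP : ZFModel.UBP M) :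
    ZFModel.FiniteSubsetSelection M ∧ ZFModel.PCMC M ∧ ZFModel.CMC M := by
  have : ZFModel.ZF M := ⟨hZF⟩
  have h := hUBP.cmc
  exact ⟨h.finiteSubsetSelection, h.pcmc, h⟩
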